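/- Let $n\ge 1$ and $L\ge 1$ be integers, let $\Sigma\in\mathbb R^{n\times n}$ be a symmetric positive semidefinite matrix (possibly singular), and let $\tilde x_1,\dots,\tilde x_L$ be i.i.d. random vectors with the Gaussian law $\mathcal N(0,\Sigma)$. Put $$\widehat\Sigma=\frac1L\sum_{\ell=1}^{L}\tilde x_\ell\tilde x_\ell^{\top},$$ and let $\|\cdot\|$ denote the spectral norm of a matrix. Then for every $\delta>0$: if $$L\;\ge\;4\,n^{1/2}\,\mathrm{tr}(\Sigma)\left(\frac{\|\Sigma\|}{\delta^{2}}+\frac{4}{\delta}\right),$$ then $$\mathbb P\bigl\{\|\widehat\Sigma-\Sigma\|\le\delta\bigr\}\;>\;1-2n\exp(-\sqrt n).$$ -/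

import Mathlib

open MeasureTheory ProbabilityTheory

/- The norm on square matrices is the spectral norm (operator norm for the Euclidean norm). -/
open scoped Matrix.Norms.L2Operator

/-- The (uncentred) sample covariance matrix `(1 / L) ∑ₗ xₗ xₗᵀ` of `L` vectors in `ℝⁿ`. -/
noncomputable def sampleCovariance {n L : ℕ} (x : Fin L → EuclideanSpace ℝ (Fin n)) :
    Matrix (Fin n) (Fin n) ℝ :=
  (1 / (L : ℝ)) • ∑ l, Matrix.vecMulVec (x l).ofLp (x l).ofLp

/-!
The proof is the Laplace transform method for sums of independent random matrices, in the form
available for identically distributed summands. If `‖Σ̂ - S‖ > δ`, then `Σ̂ - S` has an eigenvalue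
above `δ` or below `-δ`, and for `θ > 0` the trace of `exp (± θ L (Σ̂ - S))` is at least
`exp (θ L δ)`. Markov's inequality therefore reduces the claim to a bound on the expected trace of
the exponential of `∑ₗ Yₗ`, where `Yₗ = ± θ (xₗ xₗᵀ - S)`.

The Golden–Thompson inequality `tr exp (A + B) ≤ tr (exp A exp B)` (`Matrix.trace_exp_add_le`) and
independence give `E tr exp (∑ₗ Yₗ) ≤ n c ^ L` as soon as the quadratic form of `E exp Yₗ` is at
most `c ‖v‖²` (`iIndepFun.integral_trace_exp_sum_le`). Golden–Thompson follows from the Lie–Trotter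
product formula and the inequality `tr ((C D) ^ m) ≤ tr (C ^ m D ^ m)` for `m` a power of two
(`Matrix.trace_pow_two_pow_le`).

To bound `E exp Y`, the scalar inequality `exp y ≤ 1 + y + (1 / 2 + (exp s - 1) / 6) y²`, valid for
`y ≤ s` and `s ≥ 0`, is applied to the eigenvalues of `Y`, with `s = θ ‖x‖²` for the sign `+` and
`s = θ ‖S‖` for the sign `-`. The linear term has mean zero, and the quadratic term is computed
exactly from fourth moments: `E (x xᵀ - S)² = (tr S) S + S²`, which is at most `2 (tr S) ‖S‖`. The
remainder for the sign `+` involves `E (exp (θ ‖x‖²) - 1) ‖x‖² ⟨v, x⟩²`. There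
`‖x‖² = ∑ⱼ xⱼ²` is an average of multiples of squares of standard Gaussian variables, which need not
be independent; convexity reduces the moment to pairs of such variables, and a tangent-line
inequality (`mul_exp_sub_one_mul_le`) reduces the pairs to one variable. The outcome is
`c = 1 + θ² (tr S) ‖S‖ / (1 - 8 θ tr S)`, for which `θ = δ / ((2 ‖S‖ + 8 δ) tr S)` yields the stated
sample size.
-/

/-! ### The Golden–Thompson inequality -/

namespace Matrix

variable {ι : Type*} [Fintype ι]

lemma trace_conjTranspose_mul_self_nonneg (X : Matrix ι ι ℝ) : 0 ≤ (Xᴴ * X).trace :=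
  (posSemidef_conjTranspose_mul_self X).trace_nonneg

lemma two_mul_trace_mul_le {C D : Matrix ι ι ℝ} (hC : C.IsHermitian) (hD : D.IsHermitian) :
    2 * (C * D).trace ≤ (C * C).trace + (D * D).trace := by
  have h := trace_conjTranspose_mul_self_nonneg (C - D)
  rw [conjTranspose_sub, hC.eq, hD.eq] at h
  simp only [sub_mul, mul_sub, trace_sub] at h
  rw [trace_mul_comm D C] at h
  linarith

lemma trace_mul_self_le (X : Matrix ι ι ℝ) : (X * X).trace ≤ (Xᴴ * X).trace := by
  have h := trace_conjTranspose_mul_self_nonneg (X - Xᴴ)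
  have h1 : (Xᴴ * Xᴴ).trace = (X * X).trace := by
    rw [← conjTranspose_mul, trace_conjTranspose, star_trivial]
  have h2 := trace_mul_comm X Xᴴ
  simp only [conjTranspose_sub, conjTranspose_conjTranspose, sub_mul, mul_sub, trace_sub] at h
  linarith

variable [DecidableEq ι]

lemma trace_mul_pow_comm (X Y : Matrix ι ι ℝ) (m : ℕ) :
    ((X * Y) ^ m).trace = ((Y * X) ^ m).trace := by
  cases m with
  | zero => simp
  | succ m =>
    have h : ∀ k : ℕ, (X * Y) ^ (k + 1) = X * ((Y * X) ^ k * Y) := by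
      intro k
      induction k with
      | zero => simp
      | succ k ih => rw [pow_succ', ih, pow_succ' (Y * X)]; simp only [Matrix.mul_assoc]
    rw [h, trace_mul_comm, pow_succ, Matrix.mul_assoc]

/-- Two trace inequalities proved by a simultaneous induction: each doubling of the exponent in one
of them uses both of them at the previous stage. -/
lemma trace_pow_two_pow_le (k : ℕ) :
    (∀ X : Matrix ι ι ℝ, (X ^ 2 ^ (k + 1)).trace ≤ ((Xᴴ * X) ^ 2 ^ k).trace) ∧
    ∀ C D : Matrix ι ι ℝ, C.IsHermitian → D.IsHermitian →
      ((C * D) ^ 2 ^ k).trace ≤ (C ^ 2 ^ k * D ^ 2 ^ k).trace := by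
  induction k with
  | zero =>
    refine ⟨fun X => ?_, fun C D _ _ => by simp⟩
    simpa [pow_two] using trace_mul_self_le X
  | succ k ih =>
    obtain ⟨iha, ihb⟩ := ih
    refine ⟨fun X => ?_, fun C D hC hD => ?_⟩
    · have hP : (Xᴴ * X).IsHermitian := isHermitian_conjTranspose_mul_self X
      have hQ : (X * Xᴴ).IsHermitian := isHermitian_mul_conjTranspose_self X
      calc (X ^ 2 ^ (k + 1 + 1)).trace = ((X * X) ^ 2 ^ (k + 1)).trace := by
            rw [← pow_two, ← pow_mul, pow_succ' 2 (k + 1)]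
        _ ≤ (((X * X)ᴴ * (X * X)) ^ 2 ^ k).trace := iha _
        _ = (((Xᴴ * X) * (X * Xᴴ)) ^ 2 ^ k).trace := by
            rw [conjTranspose_mul, Matrix.mul_assoc, trace_mul_pow_comm]
            simp only [Matrix.mul_assoc]
        _ ≤ ((Xᴴ * X) ^ 2 ^ k * (X * Xᴴ) ^ 2 ^ k).trace := ihb _ _ hP hQ
        _ ≤ ((Xᴴ * X) ^ 2 ^ (k + 1)).trace := by
            have h := two_mul_trace_mul_le (hP.pow (2 ^ k)) (hQ.pow (2 ^ k))
            rw [← pow_add, ← pow_add, ← two_mul, ← pow_succ', trace_mul_pow_comm X] at h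
            linarith
    · calc ((C * D) ^ 2 ^ (k + 1)).trace ≤ (((C * D)ᴴ * (C * D)) ^ 2 ^ k).trace := iha _
        _ = (((C * C) * (D * D)) ^ 2 ^ k).trace := by
            rw [conjTranspose_mul, hC.eq, hD.eq, Matrix.mul_assoc, trace_mul_pow_comm]
            simp only [Matrix.mul_assoc]
        _ ≤ ((C * C) ^ 2 ^ k * (D * D) ^ 2 ^ k).trace := by
            have h := ihb (C ^ 2) (D ^ 2) (hC.pow 2) (hD.pow 2)
            simpa only [pow_two] using h
        _ = (C ^ 2 ^ (k + 1) * D ^ 2 ^ (k + 1)).trace := by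
            rw [← pow_two, ← pow_two, ← pow_mul, ← pow_mul, ← pow_succ']

end Matrix

section LieTrotter

open NormedSpace Filter Topology

variable {𝔸 : Type*} [NormedRing 𝔸]

lemma norm_pow_sub_pow_le {a b : 𝔸} {M : ℝ} (hM : 1 ≤ M) (ha : ‖a‖ ≤ M) (hb : ‖b‖ ≤ M) (m : ℕ) :
    ‖a ^ m - b ^ m‖ ≤ m * ‖a - b‖ * M ^ m := by
  have hM0 : 0 ≤ M := by linarith
  have hpow : ∀ k : ℕ, ‖b ^ (k + 1)‖ ≤ M ^ (k + 1) := fun k =>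
    (norm_pow_le' b k.succ_pos).trans (pow_le_pow_left₀ (norm_nonneg _) hb _)
  induction m with
  | zero => simp
  | succ m ih =>
    rcases m with _ | m
    · simpa using le_mul_of_one_le_right (norm_nonneg _) hM
    have h : a ^ (m + 1 + 1) - b ^ (m + 1 + 1)
        = a * (a ^ (m + 1) - b ^ (m + 1)) + (a - b) * b ^ (m + 1) := by
      rw [pow_succ' a (m + 1), pow_succ' b (m + 1)]; noncomm_ring
    rw [h]
    calc _ ≤ ‖a‖ * ‖a ^ (m + 1) - b ^ (m + 1)‖ + ‖a - b‖ * ‖b ^ (m + 1)‖ :=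
          (norm_add_le _ _).trans (add_le_add (norm_mul_le _ _) (norm_mul_le _ _))
      _ ≤ M * ((m + 1 : ℕ) * ‖a - b‖ * M ^ (m + 1)) + ‖a - b‖ * M ^ (m + 1 + 1) := by
          gcongr
          exact (hpow m).trans (pow_le_pow_right₀ hM (by omega))
      _ = _ := by push_cast; ring

variable [NormedAlgebra ℝ 𝔸] [NormOneClass 𝔸]

lemma norm_exp_le_exp_norm (x : 𝔸) : ‖exp x‖ ≤ Real.exp ‖x‖ := by
  rw [exp_eq_tsum ℝ, Real.exp_eq_exp_ℝ, exp_eq_tsum ℝ]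
  refine tsum_of_norm_bounded (expSeries_summable' (𝕂 := ℝ) ‖x‖).hasSum fun k => ?_
  rw [norm_smul, smul_eq_mul, Real.norm_of_nonneg (by positivity)]
  gcongr
  exact norm_pow_le x k

/-- The Lie–Trotter product formula, along the exponents `2 ^ k`. -/
lemma tendsto_exp_mul_exp_pow_two_pow [CompleteSpace 𝔸] (A B : 𝔸) :
    Tendsto (fun k : ℕ => (exp ((1 / 2 : ℝ) ^ k • A) * exp ((1 / 2 : ℝ) ^ k • B)) ^ 2 ^ k)
      atTop (𝓝 (exp (A + B))) := by
  have hderiv : HasDerivAt (fun t : ℝ => exp (t • A) * exp (t • B) - exp (t • (A + B))) 0 0 := by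
    have h := ((hasDerivAt_exp_smul_const A (0 : ℝ)).mul (hasDerivAt_exp_smul_const B (0 : ℝ))).sub
      (hasDerivAt_exp_smul_const (A + B) (0 : ℝ))
    refine h.congr_deriv ?_
    simp
  have ht : Tendsto (fun k : ℕ => (1 / 2 : ℝ) ^ k) atTop (𝓝 0) :=
    tendsto_pow_atTop_nhds_zero_of_lt_one (by norm_num) (by norm_num)
  have hlo := (hasDerivAt_iff_isLittleO.1 hderiv).comp_tendsto ht
  simp only [zero_smul, exp_zero, mul_one, sub_self, sub_zero, smul_zero, Function.comp_def] at hlo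
  have hlim := (hlo.norm_left.tendsto_div_nhds_zero).mul_const (Real.exp (‖A‖ + ‖B‖))
  rw [zero_mul] at hlim
  rw [tendsto_iff_norm_sub_tendsto_zero]
  refine squeeze_zero (fun _ => norm_nonneg _) (fun k => ?_) hlim
  set t : ℝ := (1 / 2 : ℝ) ^ k with htdef
  have htpos : 0 < t := by positivity
  have htk : t * ((2 ^ k : ℕ) : ℝ) = 1 := by rw [htdef]; push_cast; rw [← mul_pow]; norm_num
  let _ : NormedAlgebra ℚ 𝔸 := NormedAlgebra.restrictScalars ℚ ℝ 𝔸
  have hexp : exp (A + B) = exp (t • (A + B)) ^ 2 ^ k := by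
    rw [← exp_nsmul, ← Nat.cast_smul_eq_nsmul ℝ, smul_smul, mul_comm, htk, one_smul]
  have hM : Real.exp (t * (‖A‖ + ‖B‖)) ^ 2 ^ k = Real.exp (‖A‖ + ‖B‖) := by
    rw [← Real.exp_nat_mul, ← mul_assoc, mul_comm _ t, htk, one_mul]
  have h1 : ‖exp (t • A) * exp (t • B)‖ ≤ Real.exp (t * (‖A‖ + ‖B‖)) := by
    refine (norm_mul_le _ _).trans ?_
    rw [mul_add, Real.exp_add]
    have hs : ∀ Z : 𝔸, ‖exp (t • Z)‖ ≤ Real.exp (t * ‖Z‖) := fun Z => by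
      simpa [norm_smul, abs_of_pos htpos] using norm_exp_le_exp_norm (t • Z)
    gcongr <;> exact hs _
  have h2 : ‖exp (t • (A + B))‖ ≤ Real.exp (t * (‖A‖ + ‖B‖)) := by
    refine (norm_exp_le_exp_norm _).trans (Real.exp_le_exp.2 ?_)
    rw [norm_smul, Real.norm_of_nonneg htpos.le]
    gcongr
    exact norm_add_le _ _
  have h := norm_pow_sub_pow_le (Real.one_le_exp (by positivity)) h1 h2 (2 ^ k)
  rw [hM, ← hexp] at h
  refine h.trans (le_of_eq ?_)
  have : ((2 ^ k : ℕ) : ℝ) = t⁻¹ := by rw [← mul_eq_one_iff_eq_inv₀ htpos.ne', mul_comm, htk]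
  rw [this]
  ring

end LieTrotter

open NormedSpace in
/-- The **Golden–Thompson inequality** for real symmetric matrices. -/
theorem Matrix.trace_exp_add_le {ι : Type*} [Fintype ι] [DecidableEq ι] [Nonempty ι]
    {A B : Matrix ι ι ℝ} (hA : A.IsHermitian) (hB : B.IsHermitian) :
    (exp (A + B)).trace ≤ (exp A * exp B).trace := by
  have : NormOneClass (Matrix ι ι ℝ) := ⟨CStarRing.norm_one⟩
  have hlim := ((continuous_id.matrix_trace (R := ℝ)).tendsto _).comp
    (tendsto_exp_mul_exp_pow_two_pow A B)
  refine le_of_tendsto hlim (Filter.Eventually.of_forall fun k => ?_)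
  have hherm : ∀ {Z : Matrix ι ι ℝ}, Z.IsHermitian →
      (exp ((1 / 2 : ℝ) ^ k • Z)).IsHermitian := fun hZ =>
    IsHermitian.exp (by rw [IsHermitian, conjTranspose_smul, hZ.eq, star_trivial])
  have hpow : ∀ Z : Matrix ι ι ℝ, exp ((1 / 2 : ℝ) ^ k • Z) ^ 2 ^ k = exp Z := fun Z => by
    rw [← Matrix.exp_nsmul, ← Nat.cast_smul_eq_nsmul ℝ, smul_smul]
    push_cast
    rw [← mul_pow]
    norm_num
  have h := (trace_pow_two_pow_le k).2 _ _ (hherm hA) (hherm hB)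
  rw [hpow, hpow] at h
  exact h

/-! ### Scalar inequalities for the exponential -/

/-- Taylor's inequality of order two; the excess over the second-order term is controlled on all of
`(-∞, s]` by one coefficient that vanishes as `s → 0`. -/
lemma Real.exp_le_quadratic_of_le {y s : ℝ} (hs : 0 ≤ s) (hys : y ≤ s) :
    Real.exp y ≤ 1 + y + (1 / 2 + (Real.exp s - 1) / 6) * y ^ 2 := by
  rcases le_total y 0 with hy | hy
  · have h := Real.quadratic_le_exp_of_nonneg (neg_nonneg.2 hy)
    have h1 : Real.exp y * Real.exp (-y) = 1 := by rw [← Real.exp_add]; simp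
    have h2 : Real.exp y * (1 + -y + (-y) ^ 2 / 2) ≤ 1 := by
      exact (mul_le_mul_of_nonneg_left h (Real.exp_pos y).le).trans h1.le
    have h3 : Real.exp y ≤ 1 + y + y ^ 2 / 2 := by
      have h4 : 0 < 1 + -y + (-y) ^ 2 / 2 := by nlinarith
      refine le_of_mul_le_mul_right (h2.trans ?_) h4
      nlinarith [sq_nonneg (y ^ 2)]
    have h5 : 0 ≤ (Real.exp s - 1) / 6 * y ^ 2 :=
      mul_nonneg (by linarith [Real.one_le_exp hs]) (sq_nonneg y)
    linarith
  · -- The function below is monotone on `[0, ∞)` because its derivative is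
    -- `(t / 3) * (1 - exp (-t) * (1 + t))`.
    have hder : ∀ t : ℝ, HasDerivAt
        (fun t : ℝ => Real.exp (-t) * (1 + t + t ^ 2 / 3) + t ^ 2 / 6)
        (t / 3 * (1 - Real.exp (-t) * (1 + t))) t := by
      intro t
      have h1 : HasDerivAt (fun t : ℝ => Real.exp (-t)) (Real.exp (-t) * -1) t :=
        (hasDerivAt_neg t).exp
      have h2 : HasDerivAt (fun t : ℝ => 1 + t + t ^ 2 / 3) (1 + 2 * t / 3) t := by
        refine (((hasDerivAt_id t).const_add 1).fun_add
          (((hasDerivAt_id t).fun_pow 2).div_const 3)).congr_deriv ?_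
        simp
      have h3 : HasDerivAt (fun t : ℝ => t ^ 2 / 6) (2 * t / 6) t := by
        simpa using ((hasDerivAt_id t).pow 2).div_const 6
      refine ((h1.mul h2).add h3).congr_deriv ?_
      ring
    have hmono : MonotoneOn (fun t : ℝ => Real.exp (-t) * (1 + t + t ^ 2 / 3) + t ^ 2 / 6)
        (Set.Ici 0) := by
      refine monotoneOn_of_deriv_nonneg (convex_Ici 0)
        (fun t _ => (hder t).continuousAt.continuousWithinAt)
        (fun t _ => (hder t).differentiableAt.differentiableWithinAt) fun t ht => ?_
      rw [interior_Ici] at ht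
      rw [(hder t).deriv]
      have h1 : Real.exp (-t) * Real.exp t = 1 := by rw [← Real.exp_add]; simp
      have h2 : Real.exp (-t) * (1 + t) ≤ 1 := by
        rw [← h1]
        gcongr
        linarith [Real.add_one_le_exp t]
      exact mul_nonneg (by linarith [Set.mem_Ioi.1 ht]) (by linarith)
    have h := hmono (Set.mem_Ici.2 le_rfl) (Set.mem_Ici.2 hy) hy
    norm_num at h
    have h1 : Real.exp y * Real.exp (-y) = 1 := by rw [← Real.exp_add]; simp
    have h2 := mul_le_mul_of_nonneg_left h (Real.exp_pos y).le
    rw [mul_one, mul_add, ← mul_assoc, h1, one_mul] at h2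
    have h3 : (Real.exp y - 1) / 6 * y ^ 2 ≤ (Real.exp s - 1) / 6 * y ^ 2 := by gcongr
    linarith

lemma monotoneOn_mul_exp_sub_one :
    MonotoneOn (fun t : ℝ => t * (Real.exp t - 1)) (Set.Ici 0) := by
  intro a ha b hb hab
  have ha' : 0 ≤ a := ha
  have h1 := Real.one_le_exp ha'
  dsimp only
  gcongr

lemma convexOn_mul_exp_sub_one :
    ConvexOn ℝ (Set.Ici 0) (fun t : ℝ => t * (Real.exp t - 1)) := by
  have hexp : ConvexOn ℝ (Set.Ici 0) (fun t : ℝ => Real.exp t - 1) := by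
    have h := (convexOn_exp.subset (Set.subset_univ _) (convex_Ici 0)).add_const (-1)
    exact h.congr fun t _ => by simp [sub_eq_add_neg]
  refine (convexOn_id (convex_Ici 0)).mul hexp (fun t ht => ht) (fun t ht => ?_) ?_
  · linarith [Real.one_le_exp (show (0 : ℝ) ≤ t from ht)]
  · refine MonotoneOn.monovaryOn (fun a _ b _ h => h) fun a _ b _ h => ?_
    gcongr

/-- The tangent-line inequality for the convex primitive of `t * (exp t - 1)`. It bounds a product
of functions of two variables by a sum of functions of one variable, with equality at `a = b`. -/
lemma mul_exp_sub_one_mul_le {a b : ℝ} (ha : 0 ≤ a) (hb : 0 ≤ b) :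
    a * (Real.exp a - 1) * b ≤ a * (Real.exp a - 1) * a
      - ((a - 1) * Real.exp a - a ^ 2 / 2) + ((b - 1) * Real.exp b - b ^ 2 / 2) := by
  have hder : ∀ t : ℝ, HasDerivAt (fun t : ℝ => (t - 1) * Real.exp t - t ^ 2 / 2)
      (t * (Real.exp t - 1)) t := by
    intro t
    have h := (((hasDerivAt_id t).sub_const 1).mul (Real.hasDerivAt_exp t)).sub
      (((hasDerivAt_id t).pow 2).div_const 2)
    refine h.congr_deriv ?_
    simp
    ring
  have hc : ∀ s : Set ℝ, ContinuousOn (fun t : ℝ => (t - 1) * Real.exp t - t ^ 2 / 2) s :=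
    fun s t _ => (hder t).continuousAt.continuousWithinAt
  have hd : ∀ s : Set ℝ, DifferentiableOn ℝ (fun t : ℝ => (t - 1) * Real.exp t - t ^ 2 / 2) s :=
    fun s t _ => (hder t).differentiableAt.differentiableWithinAt
  rcases le_total a b with hab | hba
  · have h := (convex_Icc a b).mul_sub_le_image_sub_of_le_deriv (hc _) (hd _)
      (C := a * (Real.exp a - 1)) (fun t ht => by
        rw [interior_Icc] at ht
        rw [(hder t).deriv]
        exact monotoneOn_mul_exp_sub_one ha (ha.trans ht.1.le) ht.1.le)
      a (Set.left_mem_Icc.2 hab) b (Set.right_mem_Icc.2 hab) hab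
    linarith
  · have h := (convex_Icc b a).image_sub_le_mul_sub_of_deriv_le (hc _) (hd _)
      (C := a * (Real.exp a - 1)) (fun t ht => by
        rw [interior_Icc] at ht
        rw [(hder t).deriv]
        exact monotoneOn_mul_exp_sub_one (hb.trans ht.1.le) ha ht.2.le)
      b (Set.left_mem_Icc.2 hba) a (Set.right_mem_Icc.2 hba) hba
    linarith

/-! ### Exponential moments of squared Gaussian variables -/

lemma integral_pow_four_gaussianReal : ∫ x, x ^ 4 ∂(gaussianReal 0 1) = 3 := by
  have h0 : (0 : ℝ) ∈ interior (integrableExpSet id (gaussianReal 0 1)) := by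
    simp [integrableExpSet_id_gaussianReal]
  have h := iteratedDeriv_mgf_zero h0 4
  rw [mgf_id_gaussianReal] at h
  simp only [zero_mul, NNReal.coe_one, one_mul, zero_add] at h
  have he : ∀ t : ℝ,
      HasDerivAt (fun t : ℝ => Real.exp (t ^ 2 / 2)) (Real.exp (t ^ 2 / 2) * t) t := by
    intro t
    refine (((hasDerivAt_id t).pow 2).div_const 2).exp.congr_deriv ?_
    simp
  have d1 : deriv (fun t : ℝ => Real.exp (t ^ 2 / 2)) = fun t => Real.exp (t ^ 2 / 2) * t :=
    funext fun t => (he t).deriv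
  have d2 : deriv (fun t : ℝ => Real.exp (t ^ 2 / 2) * t)
      = fun t => Real.exp (t ^ 2 / 2) * (t ^ 2 + 1) := by
    funext t
    rw [((he t).fun_mul (hasDerivAt_id' t)).deriv]
    simp
    ring
  have d3 : deriv (fun t : ℝ => Real.exp (t ^ 2 / 2) * (t ^ 2 + 1))
      = fun t => Real.exp (t ^ 2 / 2) * (t ^ 3 + 3 * t) := by
    funext t
    rw [((he t).fun_mul (((hasDerivAt_id' t).fun_pow 2).add_const 1)).deriv]
    simp
    ring
  have d4 : deriv (fun t : ℝ => Real.exp (t ^ 2 / 2) * (t ^ 3 + 3 * t))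
      = fun t => Real.exp (t ^ 2 / 2) * (t ^ 4 + 6 * t ^ 2 + 3) := by
    funext t
    rw [((he t).fun_mul (((hasDerivAt_id' t).fun_pow 3).fun_add
      ((hasDerivAt_id' t).const_mul 3))).deriv]
    simp
    ring
  simp only [iteratedDeriv_succ, iteratedDeriv_zero, d1, d2, d3, d4] at h
  simpa using h.symm

/-- Weighting the standard Gaussian by `exp (u x²)` dilates it by `(1 - 2u)^(-1/2)`. -/
lemma integral_mul_exp_sq_gaussianReal {u : ℝ} (hu : u < 1 / 2) (f : ℝ → ℝ) :
    ∫ x, f x * Real.exp (u * x ^ 2) ∂(gaussianReal 0 1)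
      = √(1 / (1 - 2 * u)) * ∫ x, f (√(1 / (1 - 2 * u)) * x) ∂(gaussianReal 0 1) := by
  have hpos : 0 < 1 - 2 * u := by linarith
  set c := √(1 / (1 - 2 * u)) with hc
  have hc0 : 0 < c := by positivity
  have hc2 : c ^ 2 * (1 - 2 * u) = 1 := by
    rw [hc, Real.sq_sqrt (by positivity)]; field_simp
  rw [integral_gaussianReal_eq_integral_smul one_ne_zero,
    integral_gaussianReal_eq_integral_smul one_ne_zero]
  have h := Measure.integral_comp_mul_left
    (fun x => gaussianPDFReal 0 1 x • (f x * Real.exp (u * x ^ 2))) c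
  rw [abs_of_pos (inv_pos.2 hc0), smul_eq_mul] at h
  have h' : ∫ x, gaussianPDFReal 0 1 x • (f x * Real.exp (u * x ^ 2))
      = c * ∫ x, gaussianPDFReal 0 1 (c * x) • (f (c * x) * Real.exp (u * (c * x) ^ 2)) := by
    rw [h]; field_simp
  rw [h']
  congr 2
  funext x
  have hpdf : gaussianPDFReal 0 1 (c * x) * Real.exp (u * (c * x) ^ 2) = gaussianPDFReal 0 1 x := by
    simp only [gaussianPDFReal_def, sub_zero, NNReal.coe_one, mul_one]
    rw [mul_assoc, ← Real.exp_add]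
    congr 2
    have : -(c * x) ^ 2 / 2 + u * (c * x) ^ 2 = -(x ^ 2 * (c ^ 2 * (1 - 2 * u))) / 2 := by ring
    rw [this, hc2, mul_one]
  rw [smul_eq_mul, smul_eq_mul, ← hpdf]
  ring

lemma integral_exp_sq_gaussianReal {u : ℝ} (hu : u < 1 / 2) :
    ∫ x, Real.exp (u * x ^ 2) ∂(gaussianReal 0 1) = √(1 / (1 - 2 * u)) := by
  simpa using integral_mul_exp_sq_gaussianReal hu fun _ => 1

lemma integral_pow_four_mul_exp_sq_gaussianReal {u : ℝ} (hu : u < 1 / 2) :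
    ∫ x, x ^ 4 * Real.exp (u * x ^ 2) ∂(gaussianReal 0 1)
      = 3 * (1 / (1 - 2 * u)) ^ 2 * √(1 / (1 - 2 * u)) := by
  have hpos : 0 < 1 - 2 * u := by linarith
  rw [integral_mul_exp_sq_gaussianReal hu]
  simp_rw [mul_pow]
  rw [integral_const_mul, integral_pow_four_gaussianReal, show (4 : ℕ) = 2 * 2 from rfl, pow_mul,
    Real.sq_sqrt (by positivity)]
  ring

lemma integrable_exp_sq_gaussianReal {u : ℝ} (hu : u < 1 / 2) :
    Integrable (fun x => Real.exp (u * x ^ 2)) (gaussianReal 0 1) := by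
  have hpos : 0 < 1 - 2 * u := by linarith
  refine .of_integral_ne_zero ?_
  rw [integral_exp_sq_gaussianReal hu]
  positivity

lemma integrable_pow_four_mul_exp_sq_gaussianReal {u : ℝ} (hu : u < 1 / 2) :
    Integrable (fun x => x ^ 4 * Real.exp (u * x ^ 2)) (gaussianReal 0 1) := by
  have hpos : 0 < 1 - 2 * u := by linarith
  refine .of_integral_ne_zero ?_
  rw [integral_pow_four_mul_exp_sq_gaussianReal hu]
  positivity

lemma integrable_sq_mul_exp_sq_gaussianReal {u : ℝ} (hu : u < 1 / 2) :
    Integrable (fun x => x ^ 2 * Real.exp (u * x ^ 2)) (gaussianReal 0 1) := by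
  refine ((integrable_exp_sq_gaussianReal hu).add
    (integrable_pow_four_mul_exp_sq_gaussianReal hu)).mono' (by fun_prop) (.of_forall fun x => ?_)
  rw [Real.norm_of_nonneg (by positivity), Pi.add_apply, ← one_add_mul]
  gcongr
  nlinarith [sq_nonneg (x ^ 2 - 1), sq_nonneg x]

lemma integrable_pow_four_gaussianReal : Integrable (fun x => x ^ 4) (gaussianReal 0 1) := by
  simpa using integrable_pow_four_mul_exp_sq_gaussianReal (u := 0) (by norm_num)

/-- If `X` and `Z` are centred Gaussian variables on a common space, with any dependence, then the
mixed moment below is at most the one obtained when `X` is a multiple of `Z`. -/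
lemma integral_exp_sq_sub_one_mul_sq_le {Ω : Type*} [MeasurableSpace Ω] {P : Measure Ω}
    {X Z : Ω → ℝ} {q : NNReal} (hX : HasLaw X (gaussianReal 0 q) P)
    (hZ : HasLaw Z (gaussianReal 0 1) P) {u : ℝ} (hu0 : 0 ≤ u) (hu : u < 1 / 2) :
    Integrable (fun ω => u * Z ω ^ 2 * (Real.exp (u * Z ω ^ 2) - 1) * X ω ^ 2) P ∧
    ∫ ω, u * Z ω ^ 2 * (Real.exp (u * Z ω ^ 2) - 1) * X ω ^ 2 ∂P
      ≤ 3 * q * u * ((1 / (1 - 2 * u)) ^ 3 - 1) := by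
  have hpos : 0 < 1 - 2 * u := by linarith
  have hv : 1 ≤ 1 / (1 - 2 * u) := by rw [le_div_iff₀ hpos]; linarith
  have hZm := hZ.aemeasurable
  have hXm := hX.aemeasurable
  rcases hu0.eq_or_lt with rfl | hupos
  · simp
  rcases eq_or_ne q 0 with rfl | hq
  · have hX0 : ∀ᵐ ω ∂P, X ω = 0 := by
      have h : ∀ᵐ x ∂(P.map X), x = 0 := by
        rw [hX.map_eq, gaussianReal_zero_var, ae_dirac_eq]; simp
      exact ae_of_ae_map hXm h
    have h0 : (fun ω => u * Z ω ^ 2 * (Real.exp (u * Z ω ^ 2) - 1) * X ω ^ 2) =ᵐ[P]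
        fun _ => 0 := by
      filter_upwards [hX0] with ω hω
      simp [hω]
    refine ⟨(integrable_zero _ _ _).congr h0.symm, ?_⟩
    rw [integral_congr_ae h0]
    simp
  have hq0 : (0 : ℝ) < q := by positivity
  set W : Ω → ℝ := fun ω => X ω / √q with hWdef
  have hW : HasLaw W (gaussianReal 0 1) P := by
    have h := gaussianReal_div_const hX (√q)
    simpa [hq] using h
  have hXW : ∀ ω, X ω ^ 2 = q * W ω ^ 2 := fun ω => by
    rw [hWdef]
    simp only [div_pow]
    rw [Real.sq_sqrt hq0.le]
    field_simp
  have hWm := hW.aemeasurable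
  set H : ℝ → ℝ := fun x => (u * x ^ 2 - 1) * Real.exp (u * x ^ 2) - (u * x ^ 2) ^ 2 / 2 with hH
  set J : ℝ → ℝ := fun x => u * x ^ 2 * (Real.exp (u * x ^ 2) - 1) * (u * x ^ 2) with hJ
  have hHint : Integrable H (gaussianReal 0 1) := by
    have h := (((integrable_sq_mul_exp_sq_gaussianReal hu).const_mul u).sub
      (integrable_exp_sq_gaussianReal hu)).sub
      (integrable_pow_four_gaussianReal.const_mul (u ^ 2 / 2))
    refine h.congr (.of_forall fun x => ?_)
    simp only [Pi.sub_apply, hH]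
    ring
  have hJ' : J = fun x => u ^ 2 * (x ^ 4 * Real.exp (u * x ^ 2)) - u ^ 2 * x ^ 4 := by
    funext x; rw [hJ]; ring
  have hJint : Integrable J (gaussianReal 0 1) := by
    rw [hJ']
    exact ((integrable_pow_four_mul_exp_sq_gaussianReal hu).const_mul _).sub
      (integrable_pow_four_gaussianReal.const_mul _)
  have hJval : ∫ x, J x ∂(gaussianReal 0 1) ≤ 3 * u ^ 2 * ((1 / (1 - 2 * u)) ^ 3 - 1) := by
    rw [hJ', integral_sub ((integrable_pow_four_mul_exp_sq_gaussianReal hu).const_mul _)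
      (integrable_pow_four_gaussianReal.const_mul _), integral_const_mul, integral_const_mul,
      integral_pow_four_mul_exp_sq_gaussianReal hu, integral_pow_four_gaussianReal]
    have hsqrt : √(1 / (1 - 2 * u)) ≤ 1 / (1 - 2 * u) := by
      rw [Real.sqrt_le_left (by positivity)]
      nlinarith
    calc _ ≤ u ^ 2 * (3 * (1 / (1 - 2 * u)) ^ 2 * (1 / (1 - 2 * u))) - u ^ 2 * 3 := by gcongr
      _ = _ := by ring
  have comp_int : ∀ {g : ℝ → ℝ} {V : Ω → ℝ}, HasLaw V (gaussianReal 0 1) P →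
      Integrable g (gaussianReal 0 1) → Integrable (fun ω => g (V ω)) P := by
    intro g V hV hg
    rw [← hV.map_eq] at hg
    exact hg.comp_aemeasurable hV.aemeasurable
  have comp_val : ∀ {g : ℝ → ℝ} {V : Ω → ℝ}, HasLaw V (gaussianReal 0 1) P →
      Integrable g (gaussianReal 0 1) → ∫ ω, g (V ω) ∂P = ∫ x, g x ∂(gaussianReal 0 1) := by
    intro g V hV hg
    rw [← hV.map_eq] at hg ⊢
    exact (integral_map hV.aemeasurable hg.aestronglyMeasurable).symm
  have hB : Integrable (fun ω => q / u * (J (Z ω) - H (Z ω) + H (W ω))) P :=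
    (((comp_int hZ hJint).sub (comp_int hZ hHint)).add (comp_int hW hHint)).const_mul _
  have hle : ∀ ω, u * Z ω ^ 2 * (Real.exp (u * Z ω ^ 2) - 1) * X ω ^ 2
      ≤ q / u * (J (Z ω) - H (Z ω) + H (W ω)) := fun ω => by
    have h := mul_exp_sub_one_mul_le (a := u * Z ω ^ 2) (b := u * W ω ^ 2) (by positivity)
      (by positivity)
    have h' := mul_le_mul_of_nonneg_left h (show 0 ≤ q / u by positivity)
    refine le_trans (le_of_eq ?_) h'
    rw [hXW]
    field_simp
  have hnn : ∀ ω, 0 ≤ u * Z ω ^ 2 * (Real.exp (u * Z ω ^ 2) - 1) * X ω ^ 2 := fun ω => by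
    have := Real.one_le_exp (show 0 ≤ u * Z ω ^ 2 by positivity)
    have h1 : 0 ≤ Real.exp (u * Z ω ^ 2) - 1 := by linarith
    positivity
  have hint : Integrable (fun ω => u * Z ω ^ 2 * (Real.exp (u * Z ω ^ 2) - 1) * X ω ^ 2) P := by
    refine hB.mono' (AEMeasurable.aestronglyMeasurable (by fun_prop)) (.of_forall fun ω => ?_)
    rw [Real.norm_of_nonneg (hnn ω)]
    exact hle ω
  refine ⟨hint, (integral_mono hint hB hle).trans ?_⟩
  rw [integral_const_mul, integral_add (f := fun ω => J (Z ω) - H (Z ω))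
    ((comp_int hZ hJint).sub (comp_int hZ hHint))
    (comp_int hW hHint), integral_sub (comp_int hZ hJint) (comp_int hZ hHint), comp_val hZ hJint,
    comp_val hZ hHint, comp_val hW hHint]
  calc q / u * (∫ x, J x ∂(gaussianReal 0 1) - ∫ x, H x ∂(gaussianReal 0 1)
          + ∫ x, H x ∂(gaussianReal 0 1))
      = q / u * ∫ x, J x ∂(gaussianReal 0 1) := by ring
    _ ≤ q / u * (3 * u ^ 2 * ((1 / (1 - 2 * u)) ^ 3 - 1)) := by gcongr
    _ = _ := by field_simp

/-! ### Exponentials of symmetric matrices -/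

namespace Matrix

variable {ι : Type*} [Fintype ι]

lemma PosSemidef.abs_apply_le_trace {W : Matrix ι ι ℝ} (hW : W.PosSemidef) (i j : ι) :
    |W i j| ≤ W.trace := by
  classical
  have hdiag : ∀ k, 0 ≤ W k k := fun k => hW.diag_nonneg
  have htr : ∀ k, W k k ≤ W.trace := fun k =>
    Finset.single_le_sum (f := fun k => W k k) (fun k _ => hdiag k) (Finset.mem_univ k)
  have hsym : W j i = W i j := by simpa using hW.isHermitian.apply i j
  have h1 := hW.dotProduct_mulVec_nonneg (Pi.single i 1 + Pi.single j 1)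
  have h2 := hW.dotProduct_mulVec_nonneg (Pi.single i 1 - Pi.single j 1)
  simp [mulVec_add, mulVec_sub, add_dotProduct, sub_dotProduct, dotProduct_add,
    dotProduct_sub] at h1 h2
  have hi := htr i
  have hj := htr j
  rw [abs_le]
  constructor <;> linarith

open scoped MatrixOrder in
/-- Pairing a positive semidefinite matrix with a matrix whose quadratic form is bounded. -/
lemma PosSemidef.trace_mul_le {W : Matrix ι ι ℝ} (hW : W.PosSemidef) {C : Matrix ι ι ℝ} {c : ℝ}
    (hC : ∀ v : ι → ℝ, v ⬝ᵥ C *ᵥ v ≤ c * (v ⬝ᵥ v)) : (W * C).trace ≤ c * W.trace := by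
  classical
  obtain ⟨B, rfl⟩ := CStarAlgebra.nonneg_iff_eq_star_mul_self.mp hW.nonneg
  rw [star_eq_conjTranspose] at *
  rw [Matrix.mul_assoc, trace_mul_comm, trace_mul_comm Bᴴ B, trace, trace, Finset.mul_sum]
  refine Finset.sum_le_sum fun i _ => ?_
  have h := hC (B i)
  have e1 : (B * C * Bᴴ).diag i = B i ⬝ᵥ C *ᵥ B i := by
    rw [diag_apply, Matrix.mul_assoc, mul_apply]
    simp [dotProduct, mulVec, mul_apply]
  have e2 : (B * Bᴴ).diag i = B i ⬝ᵥ B i := by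
    simp [mul_apply, dotProduct]
  rw [e1, e2]
  exact h

variable [DecidableEq ι]

lemma dotProduct_conj_diagonal_mulVec (U : Matrix ι ι ℝ) (d v : ι → ℝ) :
    v ⬝ᵥ (U * diagonal d * Uᴴ) *ᵥ v = ∑ i, d i * (Uᴴ *ᵥ v) i ^ 2 := by
  rw [← mulVec_mulVec, ← mulVec_mulVec, dotProduct_mulVec]
  have : v ᵥ* U = Uᴴ *ᵥ v := by
    rw [conjTranspose_eq_transpose_of_trivial, mulVec_transpose]
  rw [this, dotProduct]
  refine Finset.sum_congr rfl fun i _ => ?_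
  rw [mulVec_diagonal]
  ring

namespace IsHermitian

variable {Y : Matrix ι ι ℝ} (hY : Y.IsHermitian)
include hY

lemma eq_conj_diagonal :
    Y = (hY.eigenvectorUnitary : Matrix ι ι ℝ) * diagonal hY.eigenvalues *
      (hY.eigenvectorUnitary : Matrix ι ι ℝ)ᴴ := by
  conv_lhs => rw [hY.spectral_theorem, Unitary.conjStarAlgAut_apply]
  rfl

lemma exp_smul_eq_conj_diagonal (t : ℝ) :
    NormedSpace.exp (t • Y) = (hY.eigenvectorUnitary : Matrix ι ι ℝ) *
      diagonal (fun i => Real.exp (t * hY.eigenvalues i)) *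
      (hY.eigenvectorUnitary : Matrix ι ι ℝ)ᴴ := by
  set U : Matrix ι ι ℝ := (hY.eigenvectorUnitary : Matrix ι ι ℝ) with hU
  have hU1 : Uᴴ * U = 1 := Unitary.coe_star_mul_self hY.eigenvectorUnitary
  have hinv : U⁻¹ = Uᴴ := inv_eq_left_inv hU1
  have hunit : IsUnit U :=
    ⟨⟨U, Uᴴ, Unitary.coe_mul_star_self hY.eigenvectorUnitary, hU1⟩, rfl⟩
  have h1 : t • Y = U * diagonal (fun i => t * hY.eigenvalues i) * U⁻¹ := by
    conv_lhs => rw [hY.eq_conj_diagonal]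
    rw [hinv, ← Matrix.smul_mul, ← Matrix.mul_smul, ← diagonal_smul]
    rfl
  rw [h1, exp_conj _ _ hunit, exp_diagonal, hinv]
  congr 3
  funext i
  rw [Pi.coe_exp, Real.exp_eq_exp_ℝ]

lemma trace_exp_smul (t : ℝ) :
    (NormedSpace.exp (t • Y)).trace = ∑ i, Real.exp (t * hY.eigenvalues i) := by
  rw [hY.exp_smul_eq_conj_diagonal, Matrix.mul_assoc, trace_mul_comm, Matrix.mul_assoc]
  have hU1 : (hY.eigenvectorUnitary : Matrix ι ι ℝ)ᴴ * (hY.eigenvectorUnitary : Matrix ι ι ℝ) = 1 :=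
    Unitary.coe_star_mul_self hY.eigenvectorUnitary
  rw [hU1, Matrix.mul_one, trace_diagonal]

lemma posSemidef_exp : (NormedSpace.exp Y).PosSemidef := by
  have h := hY.exp_smul_eq_conj_diagonal 1
  rw [one_smul] at h
  rw [h]
  exact (PosSemidef.diagonal fun i => (Real.exp_pos _).le).mul_mul_conjTranspose_same _

/-- The matrix form of `Real.exp_le_quadratic_of_le`. -/
lemma dotProduct_exp_mulVec_le {s : ℝ} (hs : 0 ≤ s)
    (hYs : ∀ w : ι → ℝ, w ⬝ᵥ Y *ᵥ w ≤ s * (w ⬝ᵥ w)) (v : ι → ℝ) :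
    v ⬝ᵥ NormedSpace.exp Y *ᵥ v ≤ v ⬝ᵥ v + v ⬝ᵥ Y *ᵥ v +
      (1 / 2 + (Real.exp s - 1) / 6) * ((Y *ᵥ v) ⬝ᵥ (Y *ᵥ v)) := by
  set U : Matrix ι ι ℝ := (hY.eigenvectorUnitary : Matrix ι ι ℝ) with hU
  have hU1 : Uᴴ * U = 1 := Unitary.coe_star_mul_self hY.eigenvectorUnitary
  have hU2 : U * Uᴴ = 1 := Unitary.coe_mul_star_self hY.eigenvectorUnitary
  have hle : ∀ i, hY.eigenvalues i ≤ s := fun i => by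
    have h := hYs (hY.eigenvectorBasis i)
    rw [hY.mulVec_eigenvectorBasis, dotProduct_smul] at h
    have h1 : (hY.eigenvectorBasis i : ι → ℝ) ⬝ᵥ (hY.eigenvectorBasis i : ι → ℝ) = 1 := by
      have := hY.eigenvectorBasis.inner_eq_one i
      rwa [EuclideanSpace.inner_eq_star_dotProduct, star_trivial] at this
    rw [h1] at h
    simpa using h
  have e1 : v ⬝ᵥ v = ∑ i, 1 * (Uᴴ *ᵥ v) i ^ 2 := by
    rw [← dotProduct_conj_diagonal_mulVec, diagonal_one, Matrix.mul_one, hU2, one_mulVec]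
  have e2 : v ⬝ᵥ Y *ᵥ v = ∑ i, hY.eigenvalues i * (Uᴴ *ᵥ v) i ^ 2 := by
    rw [← dotProduct_conj_diagonal_mulVec, ← hY.eq_conj_diagonal]
  have e3 : (Y *ᵥ v) ⬝ᵥ (Y *ᵥ v) = ∑ i, hY.eigenvalues i ^ 2 * (Uᴴ *ᵥ v) i ^ 2 := by
    rw [← dotProduct_conj_diagonal_mulVec]
    have hsq : U * diagonal (fun i => hY.eigenvalues i ^ 2) * Uᴴ = Y * Y := by
      conv_rhs => rw [hY.eq_conj_diagonal]
      rw [← hU]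
      calc _ = U * (diagonal hY.eigenvalues * (Uᴴ * U) * diagonal hY.eigenvalues) * Uᴴ := by
            rw [hU1, Matrix.mul_one, diagonal_mul_diagonal]
            simp only [pow_two]
        _ = _ := by simp only [Matrix.mul_assoc]
    rw [hsq, ← mulVec_mulVec, dotProduct_mulVec v Y]
    congr 1
    conv_lhs => rw [← hY.eq, conjTranspose_eq_transpose_of_trivial, mulVec_transpose]
  have e4 : v ⬝ᵥ NormedSpace.exp Y *ᵥ v = ∑ i, Real.exp (hY.eigenvalues i) * (Uᴴ *ᵥ v) i ^ 2 := by
    rw [← dotProduct_conj_diagonal_mulVec]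
    have h := hY.exp_smul_eq_conj_diagonal 1
    simp only [one_smul, one_mul] at h
    rw [h]
  rw [e1, e2, e3, e4, Finset.mul_sum, ← Finset.sum_add_distrib, ← Finset.sum_add_distrib]
  refine Finset.sum_le_sum fun i _ => ?_
  have h := mul_le_mul_of_nonneg_right (Real.exp_le_quadratic_of_le hs (hle i))
    (sq_nonneg ((Uᴴ *ᵥ v) i))
  linarith

lemma norm_eq_norm_eigenvalues : ‖Y‖ = ‖hY.eigenvalues‖ := by
  conv_lhs => rw [hY.eq_conj_diagonal]
  rw [← l2_opNorm_diagonal]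
  have h1 := CStarRing.norm_mul_coe_unitary
    ((hY.eigenvectorUnitary : Matrix ι ι ℝ) * diagonal hY.eigenvalues) (star hY.eigenvectorUnitary)
  have h2 := CStarRing.norm_coe_unitary_mul hY.eigenvectorUnitary (diagonal hY.eigenvalues)
  exact h1.trans h2

/-- A symmetric matrix of large spectral norm has a large eigenvalue of one sign or the other, and
this eigenvalue alone makes the trace of the corresponding exponential large. -/
lemma exp_le_trace_exp_of_lt_norm {δ t : ℝ} (hδ : 0 ≤ δ) (ht : 0 ≤ t) (h : δ < ‖Y‖) :
    Real.exp (t * δ) ≤ (NormedSpace.exp (t • Y)).trace ∨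
      Real.exp (t * δ) ≤ (NormedSpace.exp (-t • Y)).trace := by
  rw [hY.norm_eq_norm_eigenvalues] at h
  obtain ⟨i, hi⟩ : ∃ i, δ < |hY.eigenvalues i| := by
    by_contra! hcon
    exact absurd ((pi_norm_le_iff_of_nonneg hδ).2 hcon) (not_le.2 h)
  rw [hY.trace_exp_smul, hY.trace_exp_smul]
  have hsingle : ∀ r : ℝ, Real.exp (r * hY.eigenvalues i) ≤ ∑ j, Real.exp (r * hY.eigenvalues j) :=
    fun r => Finset.single_le_sum (f := fun j => Real.exp (r * hY.eigenvalues j))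
      (fun j _ => (Real.exp_pos _).le) (Finset.mem_univ i)
  rcases lt_abs.1 hi with hi | hi
  · refine Or.inl (le_trans (Real.exp_le_exp.2 ?_) (hsingle t))
    gcongr
  · refine Or.inr (le_trans (Real.exp_le_exp.2 ?_) (hsingle (-t)))
    rw [neg_mul, ← mul_neg]
    gcongr

end IsHermitian

lemma PosSemidef.norm_le_trace {S : Matrix ι ι ℝ} (hS : S.PosSemidef) : ‖S‖ ≤ S.trace := by
  rw [hS.isHermitian.norm_eq_norm_eigenvalues, pi_norm_le_iff_of_nonneg hS.trace_nonneg]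
  intro i
  rw [Real.norm_of_nonneg (hS.eigenvalues_nonneg i), hS.isHermitian.trace_eq_sum_eigenvalues]
  exact Finset.single_le_sum (f := fun j => hS.isHermitian.eigenvalues j)
    (fun j _ => hS.eigenvalues_nonneg j) (Finset.mem_univ i)

lemma mulVec_dotProduct_mulVec_le (S : Matrix ι ι ℝ) (v : ι → ℝ) :
    (S *ᵥ v) ⬝ᵥ (S *ᵥ v) ≤ ‖S‖ ^ 2 * (v ⬝ᵥ v) := by
  have hnorm : ∀ w : ι → ℝ, w ⬝ᵥ w = ‖WithLp.toLp 2 w‖ ^ 2 := fun w => by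
    rw [EuclideanSpace.real_norm_sq_eq]
    simp [dotProduct, pow_two]
  rw [hnorm, hnorm, ← mul_pow]
  gcongr
  exact l2_opNorm_mulVec S (WithLp.toLp 2 v)

lemma dotProduct_mulVec_le (S : Matrix ι ι ℝ) (v : ι → ℝ) :
    v ⬝ᵥ S *ᵥ v ≤ ‖S‖ * (v ⬝ᵥ v) := by
  have hv : 0 ≤ v ⬝ᵥ v := by simpa using dotProduct_star_self_nonneg v
  have hcs : (v ⬝ᵥ S *ᵥ v) ^ 2 ≤ (v ⬝ᵥ v) * ((S *ᵥ v) ⬝ᵥ (S *ᵥ v)) := by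
    simpa [dotProduct, pow_two] using
      Finset.sum_mul_sq_le_sq_mul_sq Finset.univ v (S *ᵥ v)
  refine le_of_sq_le_sq ?_ (by positivity)
  refine hcs.trans ((mul_le_mul_of_nonneg_left (mulVec_dotProduct_mulVec_le S v) hv).trans
    (le_of_eq ?_))
  ring

end Matrix

/-! ### The matrix Laplace transform of an independent sum -/

open NormedSpace in
/-- The trace of the exponential of an independent sum of symmetric random matrices. The summands
are split off one at a time: Golden–Thompson separates the last one from the others, and
independence then lets its exponential be replaced by the expectation. -/
lemma ProbabilityTheory.iIndepFun.integral_trace_exp_sum_le {Ω E κ ι : Type*} [MeasurableSpace Ω]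
    {P : Measure Ω} [IsProbabilityMeasure P] [TopologicalSpace E] [SecondCountableTopology E]
    [MeasurableSpace E] [BorelSpace E] [Fintype ι] [DecidableEq ι] [Nonempty ι]
    {X : κ → Ω → E} (hX : ∀ l, AEMeasurable (X l) P) (hindep : iIndepFun X P)
    {F : E → Matrix ι ι ℝ} (hF : Continuous F) (hherm : ∀ y, (F y).IsHermitian) {c : ℝ}
    (hint : ∀ l i j, Integrable (fun ω => exp (F (X l ω)) i j) P)
    (hquad : ∀ l (v : ι → ℝ), ∫ ω, v ⬝ᵥ Matrix.mulVec (exp (F (X l ω))) v ∂P ≤ c * (v ⬝ᵥ v))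
    (hc : 0 ≤ c) (s : Finset κ) :
    Integrable (fun ω => (exp (∑ l ∈ s, F (X l ω))).trace) P ∧
      ∫ ω, (exp (∑ l ∈ s, F (X l ω))).trace ∂P ≤ Fintype.card ι * c ^ s.card := by
  classical
  have hsum : ∀ (s : Finset κ) ω, (∑ l ∈ s, F (X l ω)).IsHermitian := fun s ω =>
    Finset.sum_induction _ _ (fun _ _ => Matrix.IsHermitian.add) Matrix.isHermitian_zero
      fun l _ => hherm _
  -- entries of the exponential of a partial sum are measurable functions of its summands
  let Φ : ∀ (s : Finset κ) (_ _ : ι), (s → E) → ℝ := fun s i j y => exp (∑ l, F (y l)) i j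
  have hΦ : ∀ s i j, Measurable (Φ s i j) := fun s i j => by
    let _ : NormedAlgebra ℚ (Matrix ι ι ℝ) := NormedAlgebra.restrictScalars ℚ ℝ _
    have hcont : Continuous fun y : s → E => exp (∑ l, F (y l)) :=
      exp_continuous.comp (continuous_finsetSum _ fun l _ => hF.comp (continuous_apply l))
    exact (hcont.matrix_elem i j).measurable
  have hΦeq : ∀ s i j ω, Φ s i j (fun l : s => X l ω) = exp (∑ l ∈ s, F (X l ω)) i j :=
    fun s i j ω => by
      change exp (∑ l : s, F (X l ω)) i j = _
      rw [Finset.sum_coe_sort s fun l => F (X l ω)]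
  have hmeas : ∀ s i j, AEStronglyMeasurable (fun ω => exp (∑ l ∈ s, F (X l ω)) i j) P :=
    fun s i j => by
      simp_rw [← hΦeq]
      exact ((hΦ s i j).comp_aemeasurable
        (aemeasurable_pi_lambda _ fun l => hX l)).aestronglyMeasurable
  induction s using Finset.induction_on with
  | empty => simp
  | insert l s hl ih =>
    obtain ⟨ihint, ihle⟩ := ih
    set A : Ω → Matrix ι ι ℝ := fun ω => ∑ l ∈ s, F (X l ω) with hA
    have hAint : ∀ i j, Integrable (fun ω => exp (A ω) i j) P := fun i j =>
      ihint.mono' (hmeas s i j) (.of_forall fun ω =>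
        (hsum s ω).posSemidef_exp.abs_apply_le_trace i j)
    have hind : ∀ i j, IndepFun (fun ω => exp (A ω) i j) (fun ω => exp (F (X l ω)) j i) P := by
      intro i j
      have h := (hindep.indepFun_finset₀ s {l} (by simpa using hl) hX).comp (hΦ s i j)
        (hΦ {l} j i)
      have e1 : (Φ s i j ∘ fun ω (l : s) => X l ω) = fun ω => exp (A ω) i j :=
        funext fun ω => hΦeq s i j ω
      have e2 : (Φ {l} j i ∘ fun ω (l' : ({l} : Finset κ)) => X l' ω)
          = fun ω => exp (F (X l ω)) j i := funext fun ω => by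
        simpa using hΦeq {l} j i ω
      rwa [e1, e2] at h
    have hprod : ∀ i j, Integrable (fun ω => exp (A ω) i j * exp (F (X l ω)) j i) P := fun i j =>
      (hind i j).integrable_mul (hAint i j) (hint l j i)
    have htr : ∀ ω, (exp (A ω) * exp (F (X l ω))).trace
        = ∑ i, ∑ j, exp (A ω) i j * exp (F (X l ω)) j i := fun ω => by
      simp [Matrix.trace, Matrix.mul_apply]
    have hle : ∀ ω, (exp (∑ k ∈ insert l s, F (X k ω))).trace
        ≤ ∑ i, ∑ j, exp (A ω) i j * exp (F (X l ω)) j i := fun ω => by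
      rw [Finset.sum_insert hl, add_comm, ← htr]
      exact Matrix.trace_exp_add_le (hsum s ω) (hherm _)
    have hbound : Integrable (fun ω => ∑ i, ∑ j, exp (A ω) i j * exp (F (X l ω)) j i) P :=
      integrable_finsetSum _ fun i _ => integrable_finsetSum _ fun j _ => hprod i j
    have hint' : Integrable (fun ω => (exp (∑ k ∈ insert l s, F (X k ω))).trace) P := by
      refine hbound.mono' ?_ (.of_forall fun ω => ?_)
      · simp only [Matrix.trace, Matrix.diag_apply]
        exact Finset.aestronglyMeasurable_fun_sum _ fun i _ => hmeas _ i i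
      · rw [Real.norm_of_nonneg (hsum _ ω).posSemidef_exp.trace_nonneg]
        exact hle ω
    refine ⟨hint', (integral_mono hint' hbound hle).trans ?_⟩
    let W : Matrix ι ι ℝ := Matrix.of fun i j => ∫ ω, exp (A ω) i j ∂P
    let V : Matrix ι ι ℝ := Matrix.of fun i j => ∫ ω, exp (F (X l ω)) i j ∂P
    have hform : ∀ {G : Ω → Matrix ι ι ℝ}, (∀ i j, Integrable (fun ω => G ω i j) P) →
        ∀ v : ι → ℝ, v ⬝ᵥ Matrix.mulVec (Matrix.of fun i j => ∫ ω, G ω i j ∂P) v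
          = ∫ ω, v ⬝ᵥ Matrix.mulVec (G ω) v ∂P := by
      intro G hG v
      simp only [dotProduct, Matrix.mulVec, Matrix.of_apply]
      rw [integral_finsetSum _ fun i _ =>
        (integrable_finsetSum _ fun j _ => (hG i j).mul_const _).const_mul _]
      refine Finset.sum_congr rfl fun i _ => ?_
      rw [integral_const_mul, integral_finsetSum _ fun j _ => (hG i j).mul_const _]
      simp_rw [integral_mul_const]
    have hWtr : W.trace = ∫ ω, (exp (A ω)).trace ∂P := by
      simp only [Matrix.trace, Matrix.diag_apply, W, Matrix.of_apply]
      rw [integral_finsetSum _ fun i _ => hAint i i]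
    have hWpsd : W.PosSemidef := by
      refine Matrix.PosSemidef.of_dotProduct_mulVec_nonneg ?_ fun v => ?_
      · ext i j
        simp only [W, Matrix.conjTranspose_apply, Matrix.of_apply, star_trivial]
        congr 1
        funext ω
        simpa using (hsum s ω).posSemidef_exp.isHermitian.apply i j
      · rw [star_trivial, hform hAint]
        refine integral_nonneg fun ω => ?_
        simpa using (hsum s ω).posSemidef_exp.dotProduct_mulVec_nonneg v
    have hWV : (W * V).trace ≤ c * W.trace :=
      hWpsd.trace_mul_le fun v => by rw [hform (hint l)]; exact hquad l v
    calc ∫ ω, ∑ i, ∑ j, exp (A ω) i j * exp (F (X l ω)) j i ∂P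
        = (W * V).trace := by
          rw [integral_finsetSum _ fun i _ => integrable_finsetSum _ fun j _ => hprod i j]
          simp only [Matrix.trace, Matrix.diag_apply, Matrix.mul_apply, W, V, Matrix.of_apply]
          refine Finset.sum_congr rfl fun i _ => ?_
          rw [integral_finsetSum _ fun j _ => hprod i j]
          exact Finset.sum_congr rfl fun j _ =>
            (hind i j).integral_fun_mul_eq_mul_integral (hAint i j).1 (hint l j i).1
      _ ≤ c * W.trace := hWV
      _ ≤ c * (Fintype.card ι * c ^ s.card) := by rw [hWtr]; gcongr
      _ = _ := by rw [Finset.card_insert_of_notMem hl]; ring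

/-! ### Moments of a Gaussian vector -/

lemma integral_pow_gaussianReal_zero (q : NNReal) (k : ℕ) :
    ∫ x, x ^ k ∂(gaussianReal 0 q) = √q ^ k * ∫ x, x ^ k ∂(gaussianReal 0 1) := by
  have h : gaussianReal 0 q = (gaussianReal 0 1).map (√q * ·) := by
    rw [gaussianReal_map_const_mul, mul_zero, mul_one]
    congr 1
    ext
    simp
  rw [h, integral_map (by fun_prop) (by fun_prop)]
  simp_rw [mul_pow]
  rw [integral_const_mul]

lemma integral_sq_gaussianReal_zero (q : NNReal) : ∫ x, x ^ 2 ∂(gaussianReal 0 q) = q := by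
  have h : Var[fun x => x; gaussianReal 0 q] = q := variance_fun_id_gaussianReal
  rw [variance_eq_integral (by fun_prop)] at h
  simpa using h

lemma integral_pow_four_gaussianReal_zero (q : NNReal) :
    ∫ x, x ^ 4 ∂(gaussianReal 0 q) = 3 * (q : ℝ) ^ 2 := by
  rw [integral_pow_gaussianReal_zero, integral_pow_four_gaussianReal, show (4 : ℕ) = 2 * 2 from rfl,
    pow_mul, Real.sq_sqrt q.coe_nonneg]
  ring

lemma integrable_pow_gaussianReal (q : NNReal) (k : ℕ) :
    Integrable (fun x => x ^ k) (gaussianReal 0 q) := by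
  have h := (memLp_id_gaussianReal (μ := 0) (v := q) k).integrable_norm_pow'
  refine h.mono' (by fun_prop) (.of_forall fun x => ?_)
  simp

namespace ProbabilityTheory

variable {ι : Type*} [Fintype ι] [DecidableEq ι] {S : Matrix ι ι ℝ}

lemma hasLaw_dotProduct_multivariateGaussian (hS : S.PosSemidef) (a : ι → ℝ) :
    HasLaw (fun x : EuclideanSpace ℝ ι => a ⬝ᵥ x.ofLp)
      (gaussianReal 0 (a ⬝ᵥ S.mulVec a).toNNReal) (multivariateGaussian 0 S) where
  aemeasurable := by unfold dotProduct; fun_prop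
  map_eq := by
    have hL : (fun x : EuclideanSpace ℝ ι => a ⬝ᵥ x.ofLp) = innerSL ℝ (WithLp.toLp 2 a) := by
      funext x
      rw [innerSL_apply_apply, EuclideanSpace.inner_eq_star_dotProduct, star_trivial,
        dotProduct_comm]
    rw [hL, IsGaussian.map_eq_gaussianReal]
    congr 1
    · rw [ContinuousLinearMap.integral_comp_id_comm IsGaussian.integrable_id]
      simp
    · congr 1
      have h := covarianceBilin_self (μ := multivariateGaussian 0 S) IsGaussian.memLp_two_id
        (WithLp.toLp 2 a)
      rw [covarianceBilin_multivariateGaussian hS] at h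
      exact h.symm

lemma integrable_dotProduct_pow (hS : S.PosSemidef) (a : ι → ℝ) (k : ℕ) :
    Integrable (fun x : EuclideanSpace ℝ ι => (a ⬝ᵥ x.ofLp) ^ k) (multivariateGaussian 0 S) := by
  have hlaw := hasLaw_dotProduct_multivariateGaussian hS a
  have h := integrable_pow_gaussianReal (a ⬝ᵥ S.mulVec a).toNNReal k
  rw [← hlaw.map_eq] at h
  exact h.comp_aemeasurable hlaw.aemeasurable

lemma integral_dotProduct_pow (hS : S.PosSemidef) (a : ι → ℝ) (k : ℕ) :
    ∫ x : EuclideanSpace ℝ ι, (a ⬝ᵥ x.ofLp) ^ k ∂(multivariateGaussian 0 S)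
      = ∫ y, y ^ k ∂(gaussianReal 0 (a ⬝ᵥ S.mulVec a).toNNReal) := by
  have hlaw := hasLaw_dotProduct_multivariateGaussian hS a
  rw [← hlaw.map_eq, integral_map hlaw.aemeasurable (by fun_prop)]

omit [DecidableEq ι] in
lemma dotProduct_mulVec_self_nonneg (hS : S.PosSemidef) (a : ι → ℝ) : 0 ≤ a ⬝ᵥ S.mulVec a := by
  simpa using hS.dotProduct_mulVec_nonneg a

lemma integral_dotProduct_sq (hS : S.PosSemidef) (a : ι → ℝ) :
    ∫ x : EuclideanSpace ℝ ι, (a ⬝ᵥ x.ofLp) ^ 2 ∂(multivariateGaussian 0 S)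
      = a ⬝ᵥ S.mulVec a := by
  rw [integral_dotProduct_pow hS, integral_sq_gaussianReal_zero,
    Real.coe_toNNReal _ (dotProduct_mulVec_self_nonneg hS a)]

lemma integral_dotProduct_pow_four (hS : S.PosSemidef) (a : ι → ℝ) :
    ∫ x : EuclideanSpace ℝ ι, (a ⬝ᵥ x.ofLp) ^ 4 ∂(multivariateGaussian 0 S)
      = 3 * (a ⬝ᵥ S.mulVec a) ^ 2 := by
  rw [integral_dotProduct_pow hS, integral_pow_four_gaussianReal_zero,
    Real.coe_toNNReal _ (dotProduct_mulVec_self_nonneg hS a)]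

omit [DecidableEq ι] in
lemma dotProduct_mulVec_symm (hS : S.PosSemidef) (a b : ι → ℝ) :
    a ⬝ᵥ S.mulVec b = S.mulVec a ⬝ᵥ b := by
  rw [Matrix.dotProduct_mulVec, ← Matrix.mulVec_transpose,
    ← Matrix.conjTranspose_eq_transpose_of_trivial, hS.isHermitian.eq]

omit [DecidableEq ι] in
lemma quadraticForm_add (hS : S.PosSemidef) (a b : ι → ℝ) :
    (a + b) ⬝ᵥ S.mulVec (a + b)
      = a ⬝ᵥ S.mulVec a + b ⬝ᵥ S.mulVec b + 2 * (a ⬝ᵥ S.mulVec b) := by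
  have h : b ⬝ᵥ S.mulVec a = a ⬝ᵥ S.mulVec b := by
    rw [dotProduct_mulVec_symm hS, dotProduct_comm]
  simp only [Matrix.mulVec_add, add_dotProduct, dotProduct_add, h]
  ring

omit [DecidableEq ι] in
lemma quadraticForm_sub (hS : S.PosSemidef) (a b : ι → ℝ) :
    (a - b) ⬝ᵥ S.mulVec (a - b)
      = a ⬝ᵥ S.mulVec a + b ⬝ᵥ S.mulVec b - 2 * (a ⬝ᵥ S.mulVec b) := by
  have h : b ⬝ᵥ S.mulVec a = a ⬝ᵥ S.mulVec b := by
    rw [dotProduct_mulVec_symm hS, dotProduct_comm]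
  simp only [Matrix.mulVec_sub, sub_dotProduct, dotProduct_sub, h]
  ring

/-- The covariance of two linear functionals, by polarization. -/
lemma integral_dotProduct_mul_dotProduct (hS : S.PosSemidef) (a b : ι → ℝ) :
    Integrable (fun x : EuclideanSpace ℝ ι => (a ⬝ᵥ x.ofLp) * (b ⬝ᵥ x.ofLp))
      (multivariateGaussian 0 S) ∧
    ∫ x : EuclideanSpace ℝ ι, (a ⬝ᵥ x.ofLp) * (b ⬝ᵥ x.ofLp) ∂(multivariateGaussian 0 S)
      = a ⬝ᵥ S.mulVec b := by
  have e : (fun x : EuclideanSpace ℝ ι => (a ⬝ᵥ x.ofLp) * (b ⬝ᵥ x.ofLp))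
      = fun x => 1 / 4 * (((a + b) ⬝ᵥ x.ofLp) ^ 2 - ((a - b) ⬝ᵥ x.ofLp) ^ 2) := by
    funext x
    rw [add_dotProduct, sub_dotProduct]
    ring
  have i1 := integrable_dotProduct_pow hS (a + b) 2
  have i2 := integrable_dotProduct_pow hS (a - b) 2
  rw [e]
  refine ⟨(i1.sub i2).const_mul _, ?_⟩
  rw [integral_const_mul, integral_sub i1 i2, integral_dotProduct_sq hS, integral_dotProduct_sq hS,
    quadraticForm_add hS, quadraticForm_sub hS]
  ring

/-- The mixed fourth moment of two linear functionals (Isserlis' formula), by polarization of the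
fourth power. -/
lemma integral_dotProduct_sq_mul_dotProduct_sq (hS : S.PosSemidef) (a b : ι → ℝ) :
    Integrable (fun x : EuclideanSpace ℝ ι => (a ⬝ᵥ x.ofLp) ^ 2 * (b ⬝ᵥ x.ofLp) ^ 2)
      (multivariateGaussian 0 S) ∧
    ∫ x : EuclideanSpace ℝ ι, (a ⬝ᵥ x.ofLp) ^ 2 * (b ⬝ᵥ x.ofLp) ^ 2 ∂(multivariateGaussian 0 S)
      = (a ⬝ᵥ S.mulVec a) * (b ⬝ᵥ S.mulVec b) + 2 * (a ⬝ᵥ S.mulVec b) ^ 2 := by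
  have e : (fun x : EuclideanSpace ℝ ι => (a ⬝ᵥ x.ofLp) ^ 2 * (b ⬝ᵥ x.ofLp) ^ 2)
      = fun x => 1 / 12 * ((((a + b) ⬝ᵥ x.ofLp) ^ 4 + ((a - b) ⬝ᵥ x.ofLp) ^ 4)
        - 2 * ((a ⬝ᵥ x.ofLp) ^ 4 + (b ⬝ᵥ x.ofLp) ^ 4)) := by
    funext x
    rw [add_dotProduct, sub_dotProduct]
    ring
  have i1 := integrable_dotProduct_pow hS (a + b) 4
  have i2 := integrable_dotProduct_pow hS (a - b) 4
  have i3 := integrable_dotProduct_pow hS a 4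
  have i4 := integrable_dotProduct_pow hS b 4
  rw [e]
  refine ⟨((i1.add i2).sub ((i3.add i4).const_mul _)).const_mul _, ?_⟩
  have i5 := i1.fun_add i2
  have i6 := (i3.fun_add i4).const_mul 2
  rw [integral_const_mul, integral_sub i5 i6, integral_const_mul, integral_add i1 i2,
    integral_add i3 i4]
  simp only [integral_dotProduct_pow_four hS, quadraticForm_add hS, quadraticForm_sub hS]
  ring

/-- Jensen's inequality for `‖x‖² = ∑ⱼ xⱼ²`, written as an average, with the weights `Sⱼⱼ / tr S`,
of multiples of the normalized squares `xⱼ² / Sⱼⱼ`. A coordinate with `Sⱼⱼ = 0` vanishes almost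
surely and has weight `0`, so that the value of the quotient there is immaterial. -/
lemma ae_convexOn_norm_sq_le (hS : S.PosSemidef) (hτ : 0 < S.trace) {f : ℝ → ℝ}
    (hf : ConvexOn ℝ (Set.Ici 0) f) {θ : ℝ} (hθ : 0 ≤ θ) :
    ∀ᵐ x ∂(multivariateGaussian 0 S), f (θ * (x.ofLp ⬝ᵥ x.ofLp))
      ≤ ∑ j, S j j / S.trace * f (θ * S.trace * (x j / √(S j j)) ^ 2) := by
  have hdiag : ∀ j, 0 ≤ S j j := fun j => hS.diag_nonneg
  have hzero : ∀ᵐ x ∂(multivariateGaussian 0 S), ∀ j, S j j = 0 → x j = 0 := by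
    rw [ae_all_iff]
    intro j
    by_cases hj : S j j = 0
    · have hlaw := (measurePreserving_eval_multivariateGaussian (μ := 0) hS (i := j))
      have h : ∀ᵐ y ∂((multivariateGaussian 0 S).map fun x : EuclideanSpace ℝ ι => x j), y = 0 := by
        rw [hlaw.map_eq, hj]
        simp [ae_dirac_eq]
      filter_upwards [ae_of_ae_map hlaw.measurable.aemeasurable h] with x hx _
      exact hx
    · exact .of_forall fun x h => absurd h hj
  filter_upwards [hzero] with x hx
  have hw : ∑ j, S j j / S.trace = 1 := by
    rw [← Finset.sum_div]
    exact div_self hτ.ne'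
  have hsum : θ * (x.ofLp ⬝ᵥ x.ofLp)
      = ∑ j, (S j j / S.trace) • (θ * S.trace * (x j / √(S j j)) ^ 2) := by
    rw [dotProduct, Finset.mul_sum]
    refine Finset.sum_congr rfl fun j _ => ?_
    by_cases hj : S j j = 0
    · simp [hx j hj, hj]
    · rw [div_pow, Real.sq_sqrt (hdiag j), smul_eq_mul]
      field_simp
  rw [hsum]
  exact hf.map_sum_le (fun j _ => div_nonneg (hdiag j) hτ.le) hw
    fun j _ => Set.mem_Ici.2 (by positivity)

lemma hasLaw_normalized_coordinate (hS : S.PosSemidef) {j : ι} (hj : S j j ≠ 0) :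
    HasLaw (fun x : EuclideanSpace ℝ ι => x j / √(S j j)) (gaussianReal 0 1)
      (multivariateGaussian 0 S) := by
  have hlaw : HasLaw (fun x : EuclideanSpace ℝ ι => x j) (gaussianReal 0 (S j j).toNNReal)
      (multivariateGaussian 0 S) := by
    simpa using (measurePreserving_eval_multivariateGaussian (μ := 0) hS (i := j)).hasLaw
  have hpos : 0 < S j j := lt_of_le_of_ne hS.diag_nonneg hj.symm
  have h := gaussianReal_div_const hlaw √(S j j)
  convert! h using 2
  · simp
  · ext
    simp [Real.sq_sqrt hpos.le, hpos.le, hj]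

/-- The quadratic exponential moment of a Gaussian vector. -/
lemma integral_exp_norm_sq_le (hS : S.PosSemidef) (hτ : 0 < S.trace) {θ : ℝ} (hθ : 0 ≤ θ)
    (hu : θ * S.trace < 1 / 2) :
    Integrable (fun x : EuclideanSpace ℝ ι => Real.exp (θ * (x.ofLp ⬝ᵥ x.ofLp)))
      (multivariateGaussian 0 S) ∧
    ∫ x : EuclideanSpace ℝ ι, Real.exp (θ * (x.ofLp ⬝ᵥ x.ofLp)) ∂(multivariateGaussian 0 S)
      ≤ 1 / (1 - 2 * (θ * S.trace)) := by
  have hpos : 0 < 1 - 2 * (θ * S.trace) := by linarith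
  have hv : 1 ≤ 1 / (1 - 2 * (θ * S.trace)) := by
    rw [le_div_iff₀ hpos]
    nlinarith
  have hdiag : ∀ j, 0 ≤ S j j := fun j => hS.diag_nonneg
  have hterm : ∀ j, Integrable (fun x : EuclideanSpace ℝ ι =>
        S j j / S.trace * Real.exp (θ * S.trace * (x j / √(S j j)) ^ 2))
        (multivariateGaussian 0 S) ∧
      ∫ x : EuclideanSpace ℝ ι, S j j / S.trace * Real.exp (θ * S.trace * (x j / √(S j j)) ^ 2)
        ∂(multivariateGaussian 0 S) ≤ S j j / S.trace * (1 / (1 - 2 * (θ * S.trace))) := by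
    intro j
    by_cases hj : S j j = 0
    · simp [hj]
    have hlaw := hasLaw_normalized_coordinate hS hj
    have hint := integrable_exp_sq_gaussianReal hu
    have hval := integral_exp_sq_gaussianReal hu
    rw [← hlaw.map_eq] at hint hval
    rw [integral_map hlaw.aemeasurable (by fun_prop)] at hval
    refine ⟨(hint.comp_aemeasurable hlaw.aemeasurable).const_mul _, ?_⟩
    rw [integral_const_mul, hval]
    refine mul_le_mul_of_nonneg_left ?_ (div_nonneg (hdiag j) hτ.le)
    rw [Real.sqrt_le_left (by positivity)]
    nlinarith
  have hB := integrable_finsetSum Finset.univ fun j _ => (hterm j).1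
  have hle := ae_convexOn_norm_sq_le hS hτ
    (convexOn_exp.subset (Set.subset_univ _) (convex_Ici 0)) hθ
  have hint : Integrable (fun x : EuclideanSpace ℝ ι => Real.exp (θ * (x.ofLp ⬝ᵥ x.ofLp)))
      (multivariateGaussian 0 S) := by
    refine hB.mono' (Measurable.aestronglyMeasurable (by unfold dotProduct; fun_prop)) ?_
    filter_upwards [hle] with x hx
    rwa [Real.norm_of_nonneg (Real.exp_pos _).le]
  refine ⟨hint, (integral_mono_ae hint hB hle).trans ?_⟩
  rw [integral_finsetSum _ fun j _ => (hterm j).1]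
  refine (Finset.sum_le_sum fun j _ => (hterm j).2).trans (le_of_eq ?_)
  rw [← Finset.sum_mul, ← Finset.sum_div]
  change S.trace / S.trace * _ = _
  rw [div_self hτ.ne', one_mul]

/-- The exponential moment of `‖x‖²` weighted by the square of a linear functional. Jensen's
inequality reduces it to pairs of correlated real Gaussian variables. -/
lemma integral_exp_norm_sq_sub_one_mul_sq_le (hS : S.PosSemidef) (hτ : 0 < S.trace) {θ : ℝ}
    (hθ : 0 ≤ θ) (hu : θ * S.trace < 1 / 2) (v : ι → ℝ) :
    Integrable (fun x : EuclideanSpace ℝ ι => θ * (x.ofLp ⬝ᵥ x.ofLp) *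
      (Real.exp (θ * (x.ofLp ⬝ᵥ x.ofLp)) - 1) * (v ⬝ᵥ x.ofLp) ^ 2) (multivariateGaussian 0 S) ∧
    ∫ x : EuclideanSpace ℝ ι, θ * (x.ofLp ⬝ᵥ x.ofLp) *
      (Real.exp (θ * (x.ofLp ⬝ᵥ x.ofLp)) - 1) * (v ⬝ᵥ x.ofLp) ^ 2 ∂(multivariateGaussian 0 S)
      ≤ 3 * (v ⬝ᵥ S.mulVec v) * (θ * S.trace) * ((1 / (1 - 2 * (θ * S.trace))) ^ 3 - 1) := by
  set u := θ * S.trace with hudef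
  have hu0 : 0 ≤ u := mul_nonneg hθ hτ.le
  have hdiag : ∀ j, 0 ≤ S j j := fun j => hS.diag_nonneg
  set R := 3 * (v ⬝ᵥ S.mulVec v) * u * ((1 / (1 - 2 * u)) ^ 3 - 1) with hR
  have hterm : ∀ j, Integrable (fun x : EuclideanSpace ℝ ι => S j j / S.trace *
        (u * (x j / √(S j j)) ^ 2 * (Real.exp (u * (x j / √(S j j)) ^ 2) - 1) *
          (v ⬝ᵥ x.ofLp) ^ 2)) (multivariateGaussian 0 S) ∧
      ∫ x : EuclideanSpace ℝ ι, S j j / S.trace *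
        (u * (x j / √(S j j)) ^ 2 * (Real.exp (u * (x j / √(S j j)) ^ 2) - 1) *
          (v ⬝ᵥ x.ofLp) ^ 2) ∂(multivariateGaussian 0 S) ≤ S j j / S.trace * R := by
    intro j
    by_cases hj : S j j = 0
    · simp [hj]
    have h := integral_exp_sq_sub_one_mul_sq_le (hasLaw_dotProduct_multivariateGaussian hS v)
      (hasLaw_normalized_coordinate hS hj) hu0 hu
    rw [Real.coe_toNNReal _ (dotProduct_mulVec_self_nonneg hS v)] at h
    refine ⟨h.1.const_mul _, ?_⟩
    rw [integral_const_mul]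
    exact mul_le_mul_of_nonneg_left h.2 (div_nonneg (hdiag j) hτ.le)
  have hB := integrable_finsetSum Finset.univ fun j _ => (hterm j).1
  have hle : ∀ᵐ x ∂(multivariateGaussian 0 S), θ * (x.ofLp ⬝ᵥ x.ofLp) *
      (Real.exp (θ * (x.ofLp ⬝ᵥ x.ofLp)) - 1) * (v ⬝ᵥ x.ofLp) ^ 2
      ≤ ∑ j, S j j / S.trace * (u * (x j / √(S j j)) ^ 2 *
        (Real.exp (u * (x j / √(S j j)) ^ 2) - 1) * (v ⬝ᵥ x.ofLp) ^ 2) := by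
    filter_upwards [ae_convexOn_norm_sq_le hS hτ convexOn_mul_exp_sub_one hθ] with x hx
    refine (mul_le_mul_of_nonneg_right hx (sq_nonneg _)).trans (le_of_eq ?_)
    rw [Finset.sum_mul]
    exact Finset.sum_congr rfl fun j _ => by ring
  have hint : Integrable (fun x : EuclideanSpace ℝ ι => θ * (x.ofLp ⬝ᵥ x.ofLp) *
      (Real.exp (θ * (x.ofLp ⬝ᵥ x.ofLp)) - 1) * (v ⬝ᵥ x.ofLp) ^ 2) (multivariateGaussian 0 S) := by
    refine hB.mono' (Measurable.aestronglyMeasurable (by unfold dotProduct; fun_prop)) ?_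
    filter_upwards [hle] with x hx
    have h0 : 0 ≤ θ * (x.ofLp ⬝ᵥ x.ofLp) :=
      mul_nonneg hθ (by simpa using dotProduct_star_self_nonneg x.ofLp)
    have h1 := Real.one_le_exp h0
    rwa [Real.norm_of_nonneg (mul_nonneg (mul_nonneg h0 (by linarith)) (sq_nonneg _))]
  refine ⟨hint, (integral_mono_ae hint hB hle).trans ?_⟩
  rw [integral_finsetSum _ fun j _ => (hterm j).1]
  refine (Finset.sum_le_sum fun j _ => (hterm j).2).trans (le_of_eq ?_)
  rw [← Finset.sum_mul, ← Finset.sum_div]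
  change S.trace / S.trace * _ = _
  rw [div_self hτ.ne', one_mul]

end ProbabilityTheory

/-! ### Exponential moments of the centred rank-one matrix -/

/-- The centred rank-one matrix `x xᵀ - S`. -/
def centeredRankOne {ι : Type*} (S : Matrix ι ι ℝ) (x : EuclideanSpace ℝ ι) : Matrix ι ι ℝ :=
  Matrix.vecMulVec x.ofLp x.ofLp - S

namespace ProbabilityTheory

variable {ι : Type*} [Fintype ι] [DecidableEq ι] {S : Matrix ι ι ℝ}

omit [Fintype ι] [DecidableEq ι] in
lemma isHermitian_smul_centeredRankOne (hS : S.PosSemidef) (θ : ℝ) (x : EuclideanSpace ℝ ι) :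
    (θ • centeredRankOne S x).IsHermitian := by
  have h : (Matrix.vecMulVec x.ofLp x.ofLp).IsHermitian := by
    ext i j
    simp [Matrix.vecMulVec_apply, mul_comm]
  rw [Matrix.IsHermitian, Matrix.conjTranspose_smul, star_trivial, centeredRankOne,
    (h.sub hS.isHermitian).eq]

omit [Fintype ι] [DecidableEq ι] in
lemma continuous_centeredRankOne (S : Matrix ι ι ℝ) : Continuous (centeredRankOne S) := by
  refine continuous_matrix fun i j => ?_
  simp only [centeredRankOne, Matrix.sub_apply, Matrix.vecMulVec_apply]
  fun_prop

omit [DecidableEq ι] in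
lemma smul_centeredRankOne_mulVec (θ : ℝ) (x : EuclideanSpace ℝ ι) (v : ι → ℝ) :
    (θ • centeredRankOne S x).mulVec v = θ • ((v ⬝ᵥ x.ofLp) • x.ofLp - S.mulVec v) := by
  have h : (Matrix.vecMulVec x.ofLp x.ofLp).mulVec v = (v ⬝ᵥ x.ofLp) • x.ofLp := by
    funext i
    simp only [Matrix.mulVec, dotProduct, Matrix.vecMulVec_apply, Pi.smul_apply, smul_eq_mul,
      Finset.sum_mul]
    exact Finset.sum_congr rfl fun j _ => by ring
  rw [Matrix.smul_mulVec, centeredRankOne, Matrix.sub_mulVec, h]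

omit [DecidableEq ι] in
lemma dotProduct_smul_centeredRankOne_mulVec (θ : ℝ) (x : EuclideanSpace ℝ ι) (v : ι → ℝ) :
    v ⬝ᵥ (θ • centeredRankOne S x).mulVec v
      = θ * ((v ⬝ᵥ x.ofLp) ^ 2 - v ⬝ᵥ S.mulVec v) := by
  rw [smul_centeredRankOne_mulVec, dotProduct_smul, dotProduct_sub, dotProduct_smul, smul_eq_mul,
    smul_eq_mul, pow_two]

omit [DecidableEq ι] in
lemma dotProduct_sq_le (x v : ι → ℝ) : (v ⬝ᵥ x) ^ 2 ≤ (x ⬝ᵥ x) * (v ⬝ᵥ v) := by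
  simpa [dotProduct, pow_two, mul_comm] using Finset.sum_mul_sq_le_sq_mul_sq Finset.univ v x

omit [DecidableEq ι] in
lemma real_dotProduct_self_nonneg (x : ι → ℝ) : 0 ≤ x ⬝ᵥ x := by
  simpa using dotProduct_star_self_nonneg x

/-- The expectation of the quadratic form of `(x xᵀ - S)²`, which is that of `(tr S) S + S²`. -/
lemma integral_sq_centeredRankOne (hS : S.PosSemidef) (θ : ℝ) (v : ι → ℝ) :
    Integrable (fun x => (θ • centeredRankOne S x).mulVec v ⬝ᵥ (θ • centeredRankOne S x).mulVec v)
      (multivariateGaussian 0 S) ∧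
    ∫ x, (θ • centeredRankOne S x).mulVec v ⬝ᵥ (θ • centeredRankOne S x).mulVec v
      ∂(multivariateGaussian 0 S)
      = θ ^ 2 * (S.trace * (v ⬝ᵥ S.mulVec v) + S.mulVec v ⬝ᵥ S.mulVec v) := by
  have e : (fun x : EuclideanSpace ℝ ι =>
        (θ • centeredRankOne S x).mulVec v ⬝ᵥ (θ • centeredRankOne S x).mulVec v)
      = fun x => θ ^ 2 * (∑ j, (v ⬝ᵥ x.ofLp) ^ 2 * (Pi.single j 1 ⬝ᵥ x.ofLp) ^ 2
        - 2 * ((v ⬝ᵥ x.ofLp) * (S.mulVec v ⬝ᵥ x.ofLp)) + S.mulVec v ⬝ᵥ S.mulVec v) := by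
    funext x
    have hx : ∑ j, (v ⬝ᵥ x.ofLp) ^ 2 * (Pi.single j 1 ⬝ᵥ x.ofLp) ^ 2
        = (v ⬝ᵥ x.ofLp) ^ 2 * (x.ofLp ⬝ᵥ x.ofLp) := by
      rw [← Finset.mul_sum]
      simp only [single_dotProduct, one_mul, pow_two (x.ofLp _)]
      rfl
    rw [hx, smul_centeredRankOne_mulVec]
    simp only [dotProduct_smul, smul_dotProduct, dotProduct_sub, sub_dotProduct, smul_eq_mul]
    rw [dotProduct_comm x.ofLp (S.mulVec v)]
    ring
  have i1 := fun j => integral_dotProduct_sq_mul_dotProduct_sq hS v (Pi.single j 1)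
  have i2 := integral_dotProduct_mul_dotProduct hS v (S.mulVec v)
  have i3 := integrable_finsetSum Finset.univ fun j _ => (i1 j).1
  have i4 := i2.1.const_mul 2
  have i5 : Integrable (fun x : EuclideanSpace ℝ ι =>
      ∑ j, (v ⬝ᵥ x.ofLp) ^ 2 * (Pi.single j 1 ⬝ᵥ x.ofLp) ^ 2
        - 2 * ((v ⬝ᵥ x.ofLp) * (S.mulVec v ⬝ᵥ x.ofLp))) (multivariateGaussian 0 S) := i3.sub i4
  have i6 := i5.add (integrable_const (S.mulVec v ⬝ᵥ S.mulVec v))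
  rw [e]
  refine ⟨i6.const_mul _, ?_⟩
  rw [integral_const_mul, integral_add i5 (integrable_const _), integral_sub i3 i4,
    integral_const_mul, integral_finsetSum _ fun j _ => (i1 j).1, i2.2]
  simp_rw [(i1 _).2]
  rw [Finset.sum_add_distrib, ← Finset.mul_sum, ← Finset.mul_sum]
  have h1 : ∑ j, (Pi.single j 1 : ι → ℝ) ⬝ᵥ S.mulVec (Pi.single j 1) = S.trace := by
    simp [Matrix.trace]
  have h2 : ∑ j, (v ⬝ᵥ S.mulVec (Pi.single j 1)) ^ 2 = S.mulVec v ⬝ᵥ S.mulVec v := by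
    have hj : ∀ j, v ⬝ᵥ S.mulVec (Pi.single j 1) = S.mulVec v j := fun j => by
      rw [dotProduct_mulVec_symm hS, dotProduct_single, mul_one]
    simp_rw [hj, pow_two]
    rfl
  rw [h1, h2, dotProduct_mulVec_symm hS v (S.mulVec v), integral_const, probReal_univ, one_smul]
  ring

lemma integral_sq_centeredRankOne_le (hS : S.PosSemidef) (θ : ℝ) (v : ι → ℝ) :
    ∫ x, (θ • centeredRankOne S x).mulVec v ⬝ᵥ (θ • centeredRankOne S x).mulVec v
      ∂(multivariateGaussian 0 S) ≤ 2 * (θ ^ 2 * S.trace * ‖S‖) * (v ⬝ᵥ v) := by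
  rw [(integral_sq_centeredRankOne hS θ v).2]
  have hv := real_dotProduct_self_nonneg v
  have hn := norm_nonneg S
  have hτ := hS.norm_le_trace
  have h1 : S.trace * (v ⬝ᵥ S.mulVec v) ≤ S.trace * (‖S‖ * (v ⬝ᵥ v)) :=
    mul_le_mul_of_nonneg_left (Matrix.dotProduct_mulVec_le S v) (hn.trans hτ)
  have h2 : S.mulVec v ⬝ᵥ S.mulVec v ≤ S.trace * ‖S‖ * (v ⬝ᵥ v) := by
    refine (Matrix.mulVec_dotProduct_mulVec_le S v).trans ?_
    rw [pow_two]
    gcongr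
  calc _ ≤ θ ^ 2 * (S.trace * (‖S‖ * (v ⬝ᵥ v)) + S.trace * ‖S‖ * (v ⬝ᵥ v)) := by gcongr
    _ = _ := by ring

lemma integral_centeredRankOne (hS : S.PosSemidef) (θ : ℝ) (v : ι → ℝ) :
    Integrable (fun x => v ⬝ᵥ (θ • centeredRankOne S x).mulVec v) (multivariateGaussian 0 S) ∧
    ∫ x, v ⬝ᵥ (θ • centeredRankOne S x).mulVec v ∂(multivariateGaussian 0 S) = 0 := by
  simp_rw [dotProduct_smul_centeredRankOne_mulVec]
  have h := integrable_dotProduct_pow hS v 2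
  refine ⟨(h.sub (integrable_const _)).const_mul _, ?_⟩
  rw [integral_const_mul, integral_sub h (integrable_const _), integral_dotProduct_sq hS]
  simp

open NormedSpace in
/-- Pointwise integrable majorants of the quadratic forms of `exp (θ (x xᵀ - S))` make the entries
integrable and bound the expectation. -/
lemma integrable_exp_centeredRankOne_of_le (hS : S.PosSemidef) {θ c : ℝ}
    {B : (ι → ℝ) → EuclideanSpace ℝ ι → ℝ}
    (hB : ∀ v, Integrable (B v) (multivariateGaussian 0 S))
    (hle : ∀ v x, v ⬝ᵥ (exp (θ • centeredRankOne S x)).mulVec v ≤ B v x)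
    (hc : ∀ v, ∫ x, B v x ∂(multivariateGaussian 0 S) ≤ c * (v ⬝ᵥ v)) :
    (∀ i j, Integrable (fun x => exp (θ • centeredRankOne S x) i j) (multivariateGaussian 0 S)) ∧
    ∀ v : ι → ℝ, ∫ x, v ⬝ᵥ (exp (θ • centeredRankOne S x)).mulVec v ∂(multivariateGaussian 0 S)
      ≤ c * (v ⬝ᵥ v) := by
  let _ : NormedAlgebra ℚ (Matrix ι ι ℝ) := NormedAlgebra.restrictScalars ℚ ℝ _
  have hcont : Continuous fun x => exp (θ • centeredRankOne S x) :=
    exp_continuous.comp ((continuous_centeredRankOne S).const_smul θ)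
  have hint : ∀ i j,
      Integrable (fun x => exp (θ • centeredRankOne S x) i j) (multivariateGaussian 0 S) := by
    intro i j
    refine (integrable_finsetSum Finset.univ fun k _ => hB (Pi.single k 1)).mono'
      (hcont.matrix_elem i j).aestronglyMeasurable (.of_forall fun x => ?_)
    have hpsd := (isHermitian_smul_centeredRankOne hS θ x).posSemidef_exp
    refine (hpsd.abs_apply_le_trace i j).trans ?_
    refine Finset.sum_le_sum fun k _ => ?_
    simpa using hle (Pi.single k 1) x
  refine ⟨hint, fun v => (integral_mono ?_ (hB v) (hle v)).trans (hc v)⟩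
  simp only [dotProduct, Matrix.mulVec]
  exact integrable_finsetSum _ fun i _ =>
    (integrable_finsetSum _ fun j _ => (hint i j).mul_const _).const_mul _

lemma one_div_one_sub_pow_three_le {u : ℝ} (hu0 : 0 ≤ u) (hu : 8 * u < 1) :
    (1 / (1 - 2 * u)) ^ 3 + (1 / (1 - 2 * u) - 1) / 3 ≤ 1 / (1 - 8 * u) := by
  have h2 : 0 < 1 - 2 * u := by linarith
  have h8 : 0 < 1 - 8 * u := by linarith
  have e : (1 / (1 - 2 * u)) ^ 3 + (1 / (1 - 2 * u) - 1) / 3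
      = (1 + 2 * u * (1 - 2 * u) ^ 2 / 3) / (1 - 2 * u) ^ 3 := by
    field_simp
    ring
  rw [e, div_le_div_iff₀ (by positivity) h8]
  have h3 : 0 ≤ u * u := mul_nonneg hu0 hu0
  have h4 : 0 ≤ u * u * u := mul_nonneg h3 hu0
  nlinarith [mul_nonneg h4 hu0]

open NormedSpace in
/-- The exponential moment on the side where `x xᵀ - S` is unbounded: its eigenvalues are at most
`‖x‖²`, so that the remainder in the quadratic Taylor bound is an exponential moment of `‖x‖²`. -/
lemma integral_exp_centeredRankOne_le (hS : S.PosSemidef) (hτ : 0 < S.trace) {θ : ℝ} (hθ : 0 ≤ θ)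
    (hu : 8 * (θ * S.trace) < 1) :
    (∀ i j, Integrable (fun x => exp (θ • centeredRankOne S x) i j) (multivariateGaussian 0 S)) ∧
    ∀ v : ι → ℝ, ∫ x, v ⬝ᵥ (exp (θ • centeredRankOne S x)).mulVec v ∂(multivariateGaussian 0 S)
      ≤ (1 + θ ^ 2 * S.trace * ‖S‖ / (1 - 8 * (θ * S.trace))) * (v ⬝ᵥ v) := by
  have hu0 : 0 ≤ θ * S.trace := mul_nonneg hθ hτ.le
  have hu2 : θ * S.trace < 1 / 2 := by linarith
  have hn := norm_nonneg S
  -- the remainder `r ‖Y v‖²` is split by `‖Y v‖² ≤ 2 θ² (⟨v, x⟩² ‖x‖² + ‖S v‖²)`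
  let R : (ι → ℝ) → EuclideanSpace ℝ ι → ℝ := fun v x =>
    θ / 3 * (θ * (x.ofLp ⬝ᵥ x.ofLp) * (Real.exp (θ * (x.ofLp ⬝ᵥ x.ofLp)) - 1) * (v ⬝ᵥ x.ofLp) ^ 2)
      + θ ^ 2 * (S.mulVec v ⬝ᵥ S.mulVec v) / 3 * (Real.exp (θ * (x.ofLp ⬝ᵥ x.ofLp)) - 1)
  let Q : (ι → ℝ) → EuclideanSpace ℝ ι → ℝ := fun v x =>
    (θ • centeredRankOne S x).mulVec v ⬝ᵥ (θ • centeredRankOne S x).mulVec v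
  have hR : ∀ v, Integrable (R v) (multivariateGaussian 0 S) ∧
      ∫ x, R v x ∂(multivariateGaussian 0 S) ≤ θ ^ 2 * S.trace * ‖S‖ *
        ((1 / (1 - 2 * (θ * S.trace))) ^ 3 - 1 + (1 / (1 - 2 * (θ * S.trace)) - 1) / 3) *
          (v ⬝ᵥ v) := by
    intro v
    have hm := integral_exp_norm_sq_sub_one_mul_sq_le hS hτ hθ hu2 v
    have he := integral_exp_norm_sq_le hS hτ hθ hu2
    have i1 := hm.1.const_mul (θ / 3)
    have i2 := (he.1.sub (integrable_const 1)).const_mul (θ ^ 2 * (S.mulVec v ⬝ᵥ S.mulVec v) / 3)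
    refine ⟨i1.add i2, ?_⟩
    have hval : ∫ x, R v x ∂(multivariateGaussian 0 S) = _ := integral_add i1 i2
    rw [hval, integral_const_mul, integral_const_mul,
      integral_sub he.1 (integrable_const 1), integral_const, probReal_univ, one_smul]
    have hv := real_dotProduct_self_nonneg v
    have hv1 : 1 ≤ 1 / (1 - 2 * (θ * S.trace)) := by
      rw [le_div_iff₀ (by linarith)]
      linarith
    have hv3 : 0 ≤ (1 / (1 - 2 * (θ * S.trace))) ^ 3 - 1 := sub_nonneg.2 (one_le_pow₀ hv1)
    have hv0 : 0 ≤ 1 / (1 - 2 * (θ * S.trace)) - 1 := sub_nonneg.2 hv1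
    have hq : v ⬝ᵥ S.mulVec v ≤ ‖S‖ * (v ⬝ᵥ v) := Matrix.dotProduct_mulVec_le S v
    have hSv : S.mulVec v ⬝ᵥ S.mulVec v ≤ S.trace * ‖S‖ * (v ⬝ᵥ v) := by
      refine (Matrix.mulVec_dotProduct_mulVec_le S v).trans ?_
      rw [pow_two]
      gcongr
      exact hS.norm_le_trace
    have hSv0 := real_dotProduct_self_nonneg (S.mulVec v)
    calc _ ≤ θ / 3 * (3 * (v ⬝ᵥ S.mulVec v) * (θ * S.trace) *
            ((1 / (1 - 2 * (θ * S.trace))) ^ 3 - 1))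
          + θ ^ 2 * (S.mulVec v ⬝ᵥ S.mulVec v) / 3 * (1 / (1 - 2 * (θ * S.trace)) - 1) := by
          gcongr
          · exact hm.2
          · exact he.2
      _ ≤ θ / 3 * (3 * (‖S‖ * (v ⬝ᵥ v)) * (θ * S.trace) *
            ((1 / (1 - 2 * (θ * S.trace))) ^ 3 - 1))
          + θ ^ 2 * (S.trace * ‖S‖ * (v ⬝ᵥ v)) / 3 * (1 / (1 - 2 * (θ * S.trace)) - 1) := by
          gcongr
      _ = _ := by ring
  have hQ := fun v => integral_sq_centeredRankOne hS θ v
  have hY := fun v => integral_centeredRankOne hS θ v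
  refine integrable_exp_centeredRankOne_of_le hS
    (B := fun v x => v ⬝ᵥ v + v ⬝ᵥ (θ • centeredRankOne S x).mulVec v + (1 / 2 * Q v x + R v x))
    (fun v => ((integrable_const _).add (hY v).1).add (((hQ v).1.const_mul _).add (hR v).1))
    (fun v x => ?_) fun v => ?_
  · have hs : 0 ≤ θ * (x.ofLp ⬝ᵥ x.ofLp) := mul_nonneg hθ (real_dotProduct_self_nonneg _)
    have hexp := (isHermitian_smul_centeredRankOne hS θ x).dotProduct_exp_mulVec_le hs
      (fun w => by
        rw [dotProduct_smul_centeredRankOne_mulVec, mul_assoc]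
        have h1 := dotProduct_sq_le x.ofLp w
        have h2 := dotProduct_mulVec_self_nonneg hS w
        gcongr
        linarith) v
    refine hexp.trans ?_
    rw [add_mul]
    change _ + (1 / 2 * Q v x + (Real.exp (θ * (x.ofLp ⬝ᵥ x.ofLp)) - 1) / 6 * Q v x) ≤ _
    have hr : 0 ≤ (Real.exp (θ * (x.ofLp ⬝ᵥ x.ofLp)) - 1) / 6 := by
      linarith [Real.one_le_exp hs]
    have hQle : Q v x ≤ 2 * θ ^ 2 * ((v ⬝ᵥ x.ofLp) ^ 2 * (x.ofLp ⬝ᵥ x.ofLp)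
        + S.mulVec v ⬝ᵥ S.mulVec v) := by
      have h0 := real_dotProduct_self_nonneg (θ • ((v ⬝ᵥ x.ofLp) • x.ofLp + S.mulVec v))
      simp only [Q, smul_centeredRankOne_mulVec]
      simp only [dotProduct_smul, smul_dotProduct, dotProduct_sub, sub_dotProduct, dotProduct_add,
        add_dotProduct, smul_eq_mul] at h0 ⊢
      nlinarith
    have hRle : (Real.exp (θ * (x.ofLp ⬝ᵥ x.ofLp)) - 1) / 6 * Q v x ≤ R v x := by
      refine (mul_le_mul_of_nonneg_left hQle hr).trans (le_of_eq ?_)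
      simp only [R]
      ring
    linarith
  · have hsum := integral_add ((integrable_const (v ⬝ᵥ v)).add (hY v).1)
      (((hQ v).1.const_mul (1 / 2)).add (hR v).1)
    have hsum1 := integral_add (integrable_const (μ := multivariateGaussian 0 S) (v ⬝ᵥ v)) (hY v).1
    have hsum2 := integral_add ((hQ v).1.const_mul (1 / 2)) (hR v).1
    simp only [Pi.add_apply] at hsum hsum1 hsum2
    rw [hsum1, hsum2, integral_const_mul, (hY v).2, integral_const, probReal_univ, one_smul] at hsum
    refine hsum.trans_le ?_
    have h1 := integral_sq_centeredRankOne_le hS θ v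
    have h2 := (hR v).2
    have h3 := one_div_one_sub_pow_three_le hu0 hu
    have hv := real_dotProduct_self_nonneg v
    have hc : 0 ≤ θ ^ 2 * S.trace * ‖S‖ * (v ⬝ᵥ v) := by positivity
    have h4 := mul_le_mul_of_nonneg_left h3 hc
    calc _ ≤ v ⬝ᵥ v + 0 + (1 / 2 * (2 * (θ ^ 2 * S.trace * ‖S‖) * (v ⬝ᵥ v)) +
          θ ^ 2 * S.trace * ‖S‖ *
        ((1 / (1 - 2 * (θ * S.trace))) ^ 3 - 1 + (1 / (1 - 2 * (θ * S.trace)) - 1) / 3) *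
          (v ⬝ᵥ v)) := by gcongr
      _ = v ⬝ᵥ v + θ ^ 2 * S.trace * ‖S‖ * (v ⬝ᵥ v) *
        ((1 / (1 - 2 * (θ * S.trace))) ^ 3 + (1 / (1 - 2 * (θ * S.trace)) - 1) / 3) := by ring
      _ ≤ v ⬝ᵥ v + θ ^ 2 * S.trace * ‖S‖ * (v ⬝ᵥ v) * (1 / (1 - 8 * (θ * S.trace))) := by linarith
      _ = _ := by ring

open NormedSpace in
/-- The exponential moment on the side where the eigenvalues of `S - x xᵀ` are bounded above by the
constant `‖S‖`. -/
lemma integral_exp_neg_centeredRankOne_le (hS : S.PosSemidef) {θ : ℝ} (hθ : 0 ≤ θ)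
    (hu : 8 * (θ * S.trace) < 1) :
    (∀ i j, Integrable (fun x => exp (-θ • centeredRankOne S x) i j) (multivariateGaussian 0 S)) ∧
    ∀ v : ι → ℝ, ∫ x, v ⬝ᵥ (exp (-θ • centeredRankOne S x)).mulVec v ∂(multivariateGaussian 0 S)
      ≤ (1 + θ ^ 2 * S.trace * ‖S‖ / (1 - 8 * (θ * S.trace))) * (v ⬝ᵥ v) := by
  have hn := norm_nonneg S
  have hs : 0 ≤ θ * ‖S‖ := mul_nonneg hθ hn
  have hsu : θ * ‖S‖ ≤ θ * S.trace := mul_le_mul_of_nonneg_left hS.norm_le_trace hθ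
  have hτ : 0 ≤ S.trace := hS.trace_nonneg
  have hQ := fun v => integral_sq_centeredRankOne hS (-θ) v
  have hY := fun v => integral_centeredRankOne hS (-θ) v
  refine integrable_exp_centeredRankOne_of_le hS (B := fun v x =>
      v ⬝ᵥ v + v ⬝ᵥ (-θ • centeredRankOne S x).mulVec v + (1 / 2 + (Real.exp (θ * ‖S‖) - 1) / 6) *
        ((-θ • centeredRankOne S x).mulVec v ⬝ᵥ (-θ • centeredRankOne S x).mulVec v))
    (fun v => ((integrable_const _).add (hY v).1).add ((hQ v).1.const_mul _))
    (fun v x => (isHermitian_smul_centeredRankOne hS (-θ) x).dotProduct_exp_mulVec_le hs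
      (fun w => ?_) v) fun v => ?_
  · rw [dotProduct_smul_centeredRankOne_mulVec]
    have h1 := mul_le_mul_of_nonneg_left (Matrix.dotProduct_mulVec_le S w) hθ
    have h2 := mul_nonneg hθ (sq_nonneg (w ⬝ᵥ x.ofLp))
    linarith
  · have hsum := integral_add ((integrable_const (v ⬝ᵥ v)).add (hY v).1)
      ((hQ v).1.const_mul (1 / 2 + (Real.exp (θ * ‖S‖) - 1) / 6))
    have hsum1 := integral_add (integrable_const (μ := multivariateGaussian 0 S) (v ⬝ᵥ v)) (hY v).1
    simp only [Pi.add_apply] at hsum hsum1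
    rw [hsum1, integral_const_mul, (hY v).2, integral_const, probReal_univ, one_smul] at hsum
    refine hsum.trans_le ?_
    have h1 := integral_sq_centeredRankOne_le hS (-θ) v
    have hv := real_dotProduct_self_nonneg v
    have h8 : 0 < 1 - 8 * (θ * S.trace) := by linarith
    have hE1 := Real.one_le_exp hs
    have hE : Real.exp (θ * ‖S‖) ≤ 1 / (1 - 8 * (θ * S.trace)) := by
      rw [le_div_iff₀ h8]
      have h2 : 1 - 8 * (θ * S.trace) ≤ Real.exp (-(θ * ‖S‖)) := by
        linarith [Real.add_one_le_exp (-(θ * ‖S‖))]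
      calc _ ≤ Real.exp (θ * ‖S‖) * Real.exp (-(θ * ‖S‖)) := by gcongr
        _ = 1 := by rw [← Real.exp_add]; simp
    have hc : 0 ≤ θ ^ 2 * S.trace * ‖S‖ * (v ⬝ᵥ v) := by positivity
    have hr : 0 ≤ 1 / 2 + (Real.exp (θ * ‖S‖) - 1) / 6 := by linarith
    have h3 : 2 * (1 / 2 + (Real.exp (θ * ‖S‖) - 1) / 6) ≤ 1 / (1 - 8 * (θ * S.trace)) := by
      linarith
    have h4 := mul_le_mul_of_nonneg_left h3 hc
    have h5 := mul_le_mul_of_nonneg_left h1 hr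
    rw [neg_sq] at h5
    calc _ ≤ v ⬝ᵥ v + θ ^ 2 * S.trace * ‖S‖ * (v ⬝ᵥ v) * (1 / (1 - 8 * (θ * S.trace))) := by
          linarith
      _ = _ := by ring

end ProbabilityTheory

/-! ### Concentration of the sample covariance matrix -/

/-- One side of the deviation bound: Markov's inequality for the trace exponential of
`θ L (Σ̂ - S)`. -/
lemma measureReal_exp_le_trace_exp_sampleCovariance {n L : ℕ} (hn : 1 ≤ n) (hL : 1 ≤ L)
    {S : Matrix (Fin n) (Fin n) ℝ} (hS : S.PosSemidef)
    {Ω : Type*} [MeasurableSpace Ω] {P : Measure Ω} [IsProbabilityMeasure P]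
    {x : Fin L → Ω → EuclideanSpace ℝ (Fin n)}
    (hlaw : ∀ l, HasLaw (x l) (multivariateGaussian 0 S) P) (hindep : iIndepFun x P) {θ c : ℝ}
    (hc : 0 ≤ c)
    (hint : ∀ i j, Integrable (fun y => NormedSpace.exp (θ • centeredRankOne S y) i j)
      (multivariateGaussian 0 S))
    (hquad : ∀ v : Fin n → ℝ,
      ∫ y, v ⬝ᵥ (NormedSpace.exp (θ • centeredRankOne S y)).mulVec v ∂(multivariateGaussian 0 S)
        ≤ c * (v ⬝ᵥ v)) (a : ℝ) :
    P.real {ω | Real.exp a ≤ (NormedSpace.exp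
        ((θ * L) • (sampleCovariance (fun l => x l ω) - S))).trace}
      ≤ n * c ^ L * Real.exp (-a) := by
  have : Nonempty (Fin n) := ⟨⟨0, hn⟩⟩
  have hL0 : (L : ℝ) ≠ 0 := by positivity
  have hsum : ∀ ω, ∑ l, θ • centeredRankOne S (x l ω)
      = (θ * L) • (sampleCovariance (fun l => x l ω) - S) := fun ω => by
    simp only [centeredRankOne, sampleCovariance]
    rw [← Finset.smul_sum, Finset.sum_sub_distrib, Finset.sum_const, Finset.card_univ,
      Fintype.card_fin, ← Nat.cast_smul_eq_nsmul ℝ, mul_smul, smul_sub (L : ℝ), smul_smul (L : ℝ),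
      mul_one_div_cancel hL0, one_smul]
  let _ : NormedAlgebra ℚ (Matrix (Fin n) (Fin n) ℝ) := NormedAlgebra.restrictScalars ℚ ℝ _
  have hcont : Continuous fun y => NormedSpace.exp (θ • centeredRankOne S y) :=
    NormedSpace.exp_continuous.comp ((continuous_centeredRankOne S).const_smul θ)
  have h := hindep.integral_trace_exp_sum_le (fun l => (hlaw l).aemeasurable)
    (F := fun y => θ • centeredRankOne S y) ((continuous_centeredRankOne S).const_smul θ)
    (isHermitian_smul_centeredRankOne hS θ) (c := c)
    (fun l i j => by
      have h := hint i j
      rw [← (hlaw l).map_eq] at h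
      exact h.comp_aemeasurable (hlaw l).aemeasurable)
    (fun l v => by
      have h := hquad v
      rw [← (hlaw l).map_eq, integral_map (hlaw l).aemeasurable] at h
      · exact h
      · exact (Continuous.dotProduct continuous_const
          (hcont.matrix_mulVec continuous_const)).aestronglyMeasurable) hc Finset.univ
  simp only [hsum, Fintype.card_fin, Finset.card_univ] at h
  have hmarkov := mul_meas_ge_le_integral_of_nonneg (.of_forall fun ω => ?_) h.1 (Real.exp a)
  · rw [Real.exp_neg, ← div_eq_mul_inv, le_div_iff₀' (Real.exp_pos a)]
    exact hmarkov.trans h.2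
  · rw [← hsum]
    exact (Finset.sum_induction _ _ (fun _ _ => Matrix.IsHermitian.add) Matrix.isHermitian_zero
      fun l _ => isHermitian_smul_centeredRankOne hS θ _).posSemidef_exp.trace_nonneg

theorem mainTheorem7 {n L : ℕ} (hn : 1 ≤ n) (hL : 1 ≤ L)
    {S : Matrix (Fin n) (Fin n) ℝ} (hS : S.PosSemidef)
    {Ω : Type*} [MeasurableSpace Ω] (P : Measure Ω) [IsProbabilityMeasure P]
    (x : Fin L → Ω → EuclideanSpace ℝ (Fin n))
    (hlaw : ∀ l, HasLaw (x l) (multivariateGaussian 0 S) P)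
    (hindep : iIndepFun x P)
    (δ : ℝ) (hδ : 0 < δ)
    (hsize : 4 * Real.sqrt n * S.trace * (‖S‖ / δ ^ 2 + 4 / δ) ≤ (L : ℝ)) :
    1 - 2 * n * Real.exp (-Real.sqrt n) <
      P.real {ω | ‖sampleCovariance (fun l => x l ω) - S‖ ≤ δ} := by
  have hn0 : (0 : ℝ) < n := by positivity
  have hLpos : (0 : ℝ) < L := by positivity
  rcases hS.trace_nonneg.eq_or_lt with hτ | hτ
  · -- a Gaussian vector with zero covariance vanishes almost surely
    have hS0 : S = 0 := hS.trace_eq_zero_iff.1 hτ.symm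
    subst hS0
    have hzero : ∀ᵐ ω ∂P, ∀ l, x l ω = 0 := by
      rw [ae_all_iff]
      intro l
      have h : ∀ᵐ y ∂(P.map (x l)), y = 0 := by
        rw [(hlaw l).map_eq]
        simp [multivariateGaussian, ae_dirac_eq]
      exact ae_of_ae_map (hlaw l).aemeasurable h
    have h1 : P.real {ω | ‖sampleCovariance (fun l => x l ω) - 0‖ ≤ δ} = 1 := by
      have hae : {ω | ‖sampleCovariance (fun l => x l ω) - 0‖ ≤ δ} ∈ ae P := by
        filter_upwards [hzero] with ω hω
        have h0 : sampleCovariance (fun l => x l ω) = 0 := by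
          simp [sampleCovariance, hω]
        simp [h0, hδ.le]
      rw [measureReal_congr (Filter.eventuallyEq_univ.2 hae), probReal_univ]
    rw [h1]
    have := Real.exp_pos (-√n)
    nlinarith [mul_pos hn0 this]
  set τ := S.trace with hτdef
  set σ := ‖S‖ with hσdef
  have hσ : 0 < σ := by
    rw [hσdef, norm_pos_iff]
    rintro rfl
    simp [hτdef] at hτ
  -- this choice of `θ` turns the exponential moment bound into `1 + θ δ / 2`
  set θ := δ / (2 * σ + 8 * δ) / τ with hθdef
  have hθ : 0 < θ := by positivity
  have hu : θ * τ = δ / (2 * σ + 8 * δ) := by rw [hθdef]; field_simp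
  have h8 : 1 - 8 * (θ * τ) = 2 * σ / (2 * σ + 8 * δ) := by rw [hu]; field_simp; ring
  have hu8 : 8 * (θ * τ) < 1 := by
    have : 0 < 2 * σ / (2 * σ + 8 * δ) := by positivity
    linarith
  have hcval : 1 + θ ^ 2 * τ * σ / (1 - 8 * (θ * τ)) = 1 + θ * δ / 2 := by
    have e : θ ^ 2 * τ * σ = θ * (θ * τ) * σ := by ring
    rw [h8, e, hu]
    field_simp
  have hup := integral_exp_centeredRankOne_le hS hτ hθ.le hu8
  have hlow := integral_exp_neg_centeredRankOne_le hS hθ.le hu8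
  rw [hcval] at hup hlow
  have hc : 0 ≤ 1 + θ * δ / 2 := by positivity
  have hA := measureReal_exp_le_trace_exp_sampleCovariance hn hL hS hlaw hindep hc hup.1 hup.2
    (θ * L * δ)
  have hB := measureReal_exp_le_trace_exp_sampleCovariance hn hL hS hlaw hindep hc hlow.1 hlow.2
    (θ * L * δ)
  have hexponent : √n ≤ θ * δ / 2 * L := by
    have e : θ * δ / 2 * (4 * √n * τ * (σ / δ ^ 2 + 4 / δ)) = √n := by
      rw [hθdef]
      field_simp
      ring
    calc √n = θ * δ / 2 * (4 * √n * τ * (σ / δ ^ 2 + 4 / δ)) := e.symm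
      _ ≤ θ * δ / 2 * L := by gcongr
  -- the strict inequality of the statement comes from `1 + t < exp t` for `t ≠ 0`
  have htail : n * (1 + θ * δ / 2) ^ L * Real.exp (-(θ * L * δ)) < n * Real.exp (-√n) := by
    have h1 : (1 + θ * δ / 2) ^ L < Real.exp (θ * δ / 2 * L) := by
      rw [mul_comm (θ * δ / 2) (L : ℝ), Real.exp_nat_mul]
      refine pow_lt_pow_left₀ ?_ hc (by omega)
      rw [add_comm]
      exact Real.add_one_lt_exp (by positivity)
    calc _ < n * Real.exp (θ * δ / 2 * L) * Real.exp (-(θ * L * δ)) := by gcongr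
      _ = n * Real.exp (-(θ * δ / 2 * L)) := by
          rw [mul_assoc, ← Real.exp_add]
          congr 2
          ring
      _ ≤ _ := by gcongr
  set G := {ω | ‖sampleCovariance (fun l => x l ω) - S‖ ≤ δ} with hG
  have hherm : ∀ ω, (sampleCovariance (fun l => x l ω) - S).IsHermitian := fun ω => by
    refine Matrix.IsHermitian.sub ?_ hS.isHermitian
    ext i j
    simp [sampleCovariance, Matrix.sum_apply, Matrix.vecMulVec_apply, mul_comm]
  have hcover : Gᶜ ⊆ {ω | Real.exp (θ * L * δ) ≤ (NormedSpace.exp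
        ((θ * L) • (sampleCovariance (fun l => x l ω) - S))).trace} ∪
      {ω | Real.exp (θ * L * δ) ≤ (NormedSpace.exp
        ((-θ * L) • (sampleCovariance (fun l => x l ω) - S))).trace} := by
    intro ω hω
    have hω' : δ < ‖sampleCovariance (fun l => x l ω) - S‖ := not_le.1 hω
    have h := (hherm ω).exp_le_trace_exp_of_lt_norm hδ.le (t := θ * L) (by positivity) hω'
    rwa [← neg_mul] at h
  have hcompl : P.real Gᶜ < 2 * n * Real.exp (-√n) := by
    have h := (measureReal_mono (μ := P) hcover (measure_ne_top _ _)).trans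
      (measureReal_union_le _ _)
    linarith
  have huniv : 1 ≤ P.real G + P.real Gᶜ := by
    have h := measureReal_union_le (μ := P) G Gᶜ
    rwa [Set.union_compl_self, probReal_univ] at h
  linarith
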